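/- Let $(V,\in)$ be any model of $ZF$ (no form of choice is assumed in $V$). For a class $X$ of $V$, let $OD(X)$ be the class of all sets $a$ that are definable from ordinals and elements of $X$, that is, for which there are a formula $\varphi(v,v_1,\dots,v_n)$ of the language $\{\in\}$ and parameters $p_1,\dots,p_n$, each an ordinal or an element of $X$, such that $a$ is the unique element of $V$ with $V\models\varphi(a,p_1,\dots,p_n)$. Let $HOD(X)$ be the class of all sets $a$ such that every element of the transitive closure of $\{a\}$ belongs to $OD(X)$, and let $HOD=HOD(\emptyset)$. An inner model is a transitive class $M$ that contains all ordinals, is a model of $ZF$, and is such that the axioms of $ZF$ remain valid in $V$ when the axiom schemes are applied to formulas with an additional unary predicate interpreted by $M$. Then: (a) $HOD$ satisfies the axiom of choice. (b) If $M$ is an inner model that satisfies the axiom of choice, then $HOD(M)$ satisfies the axiom of choice. -/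

import Mathlib

/-! Models of set theory are structures `(V, E)`, where `E y x` is read "`y` is an element of `x`".
The universe of sets is an arbitrary model of `ZF`; no form of choice is assumed about it. -/

namespace SetModel

/-- The relation symbols of the language of set theory: one binary symbol. -/
inductive MemRel : ℕ → Type
  | mem : MemRel 2

/-- The language `{∈}` of set theory. -/
def langMem : FirstOrder.Language.{0, 0} := ⟨fun _ => Empty, MemRel⟩

/-- The relation symbols of the language of set theory with one unary predicate symbol `U`. -/
inductive MemPredRel : ℕ → Type
  | mem : MemPredRel 2
  | pred : MemPredRel 1

/-- The language `{∈, U}`. -/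
def langMemPred : FirstOrder.Language.{0, 0} := ⟨fun _ => Empty, MemPredRel⟩

section

variable {V : Type*}

/-- The structure `(V, E)` for the language `{∈}`. -/
@[reducible] def memStructure (E : V → V → Prop) : langMem.Structure V where
  funMap := fun f _ => nomatch f
  RelMap := fun r v =>
    match r, v with
    | MemRel.mem, v => E (v 0) (v 1)

/-- The structure `(V, E, M)` for the language `{∈, U}`; the predicate `U` is interpreted by `M`. -/
@[reducible] def memPredStructure (E : V → V → Prop) (M : Set V) : langMemPred.Structure V where
  funMap := fun f _ => nomatch f
  RelMap := fun r v =>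
    match r, v with
    | MemPredRel.mem, v => E (v 0) (v 1)
    | MemPredRel.pred, v => v 0 ∈ M

/-- `(V, E)` satisfies the axioms of `ZF`, where separation and replacement are applied to all
formulas of the language `L` (with arbitrary parameters from `V`). Thus `P` and `R` below range
over the subclasses of `V` and of `V × V` that some `L`-formula defines from parameters. -/
structure SatisfiesZFIn (L : FirstOrder.Language.{0, 0}) [L.Structure V] (E : V → V → Prop) : Prop where
  extensionality : ∀ x y, (∀ z, E z x ↔ E z y) → x = y
  foundation : ∀ x, (∃ y, E y x) → ∃ y, E y x ∧ ∀ z, E z y → ¬ E z x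
  pairing : ∀ x y, ∃ p, ∀ z, E z p ↔ z = x ∨ z = y
  union : ∀ x, ∃ u, ∀ z, E z u ↔ ∃ y, E y x ∧ E z y
  powerset : ∀ x, ∃ p, ∀ y, E y p ↔ ∀ z, E z y → E z x
  infinity : ∃ w, (∃ e, E e w ∧ ∀ z, ¬ E z e) ∧
    ∀ x, E x w → ∃ s, E s w ∧ ∀ z, E z s ↔ E z x ∨ z = x
  separation : ∀ P : Set V, (Set.univ : Set V).Definable₁ L P →
    ∀ a, ∃ b, ∀ x, E x b ↔ E x a ∧ x ∈ P
  replacement : ∀ R : Set (V × V), (Set.univ : Set V).Definable₂ L R →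
    ∀ a, (∀ x, E x a → ∀ y y', (x, y) ∈ R → (x, y') ∈ R → y = y') →
      ∃ b, ∀ y, E y b ↔ ∃ x, E x a ∧ (x, y) ∈ R

/-- `(V, E)` is a model of `ZF`. -/
def SatisfiesZF (E : V → V → Prop) : Prop :=
  letI := memStructure E
  SatisfiesZFIn langMem E

/-- `p` is the unordered pair `{a, b}`. -/
def IsPair (E : V → V → Prop) (p a b : V) : Prop :=
  ∀ z, E z p ↔ z = a ∨ z = b

/-- `p` is the ordered pair `(a, b) = {{a}, {a, b}}`. -/
def IsOrderedPair (E : V → V → Prop) (p a b : V) : Prop :=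
  ∃ s t, IsPair E s a a ∧ IsPair E t a b ∧ IsPair E p s t

/-- `(V, E)` satisfies the axiom of choice: for every set `x` of nonempty sets there is a function
`f` with domain `x` such that `f(y) ∈ y` for all `y ∈ x`. -/
def SatisfiesAC (E : V → V → Prop) : Prop :=
  ∀ x, (∀ y, E y x → ∃ z, E z y) →
    ∃ f, (∀ p, E p f → ∃ y z, E y x ∧ E z y ∧ IsOrderedPair E p y z) ∧
      ∀ y, E y x → ∃! z, ∃ p, E p f ∧ IsOrderedPair E p y z

/-- The membership relation of the submodel `(M, E ↾ M)`. -/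
def restrict (E : V → V → Prop) (M : Set V) : M → M → Prop :=
  fun y x => E y x

/-- `t` is a transitive set. -/
def IsTransSet (E : V → V → Prop) (t : V) : Prop :=
  ∀ x, E x t → ∀ y, E y x → E y t

/-- `a` is an ordinal: a transitive set of transitive sets. (In the presence of the axiom of
foundation this amounts to: transitive and well-ordered by membership.) -/
def IsOrd (E : V → V → Prop) (a : V) : Prop :=
  IsTransSet E a ∧ ∀ x, E x a → IsTransSet E x

/-- The class of all ordinals of `(V, E)`. -/
def ordinals (E : V → V → Prop) : Set V := {a | IsOrd E a}

/-- `M` is an inner model of `ZF` in `(V, E)`. -/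
structure IsInnerModel (E : V → V → Prop) (M : Set V) : Prop where
  /-- `M` is a class of `V`: the axioms of `ZF` hold in `V` also when the schemes are applied to
  formulas with a predicate for `M`. -/
  isClass : letI := memPredStructure E M; SatisfiesZFIn langMemPred E
  transitive : ∀ x ∈ M, ∀ y, E y x → y ∈ M
  ordinals_subset : ordinals E ⊆ M
  satisfiesZF : SatisfiesZF (restrict E M)

/-- `OD(X)`: the elements `a` of `V` such that, for some formula `φ` of the language `{∈}` and
finitely many parameters, each of them an ordinal or an element of `X`, `a` is the only element
of `V` that satisfies `φ` in `(V, E)`. -/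
def OD (E : V → V → Prop) (X : Set V) : Set V :=
  letI := memStructure E
  {a | (ordinals E ∪ X).Definable₁ langMem {a}}

/-- `t` is the transitive closure of `{a}` in `(V, E)`: the least transitive set that contains
`a` as an element. -/
def IsTclSingleton (E : V → V → Prop) (t a : V) : Prop :=
  (IsTransSet E t ∧ E a t) ∧ ∀ s, IsTransSet E s → E a s → ∀ x, E x t → E x s

/-- `HOD(X)`: the elements `a` such that every element of the transitive closure of `{a}` is in
`OD(X)`. -/
def HOD (E : V → V → Prop) (X : Set V) : Set V :=
  {a | ∃ t, IsTclSingleton E t a ∧ ∀ x, E x t → x ∈ OD E X}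

end

end SetModel

/-! A class of sets that is enumerated by the ordinals, definably from a parameter `w`, has a
definable choice function: pick from each set the member that is enumerated first. For a parameter
`w` let `generated w` be the closure of the ordinals and `w` under finitely many operations, among
them `α ↦ V_α` and enough Gödel operations to compute, by induction on a formula, the set of tuples
from `V_α` that satisfy the formula in `V` (for a quantifier, the witnesses are collected in some
larger `V_β`). Hence everything definable from ordinals and `w` lies in `generated w`. On the other
hand `generated w` is enumerated by a definable recursion along the ordinals, so that no truth
predicate for `V` is needed.

For `HOD` this settles the matter. For `HOD(M)`, collection yields for every set `x ⊆ OD(M)` some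
`u ∈ M` such that each element of `x` is generated from an element of `u`. Choice in `M` provides an
enumeration `w ∈ M` of `u` by ordinals, and then all elements of `x` are generated from `w`. -/

namespace SetModel

open FirstOrder FirstOrder.Language Set

/-! ### Definability -/

section Definability

/-- A family of relations on `V`, of all finite arities, that contains membership and equality and
is closed under the first-order operations. Its members are the relations regarded as definable.
This abstracts from the language and the parameters. -/
structure DefinabilitySystem {V : Type*} (E : V → V → Prop) where
  IsDef : ∀ {n : ℕ}, ((Fin n → V) → Prop) → Prop
  mem : ∀ {n : ℕ} (i j : Fin n), IsDef fun v => E (v i) (v j)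
  eq : ∀ {n : ℕ} (i j : Fin n), IsDef fun v => v i = v j
  not : ∀ {n : ℕ} {P : (Fin n → V) → Prop}, IsDef P → IsDef fun v => ¬ P v
  and : ∀ {n : ℕ} {P Q : (Fin n → V) → Prop}, IsDef P → IsDef Q → IsDef fun v => P v ∧ Q v
  ex : ∀ {n : ℕ} {P : (Fin n → V) → V → Prop},
    IsDef (fun w : Fin (n + 1) → V => P (fun i => w i.succ) (w 0)) → IsDef fun v => ∃ x, P v x
  subst : ∀ {n m : ℕ} (σ : Fin n → Fin m) {P : (Fin n → V) → Prop},
    IsDef P → IsDef fun v : Fin m → V => P fun i => v (σ i)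

variable {V : Type*} {E : V → V → Prop} {n : ℕ}

/-- The relation `P` belongs to the system `𝔇`. This is a class, so that instance search can follow
the syntax of `P`. -/
class IsDefinable (𝔇 : DefinabilitySystem E) (P : (Fin n → V) → Prop) : Prop where
  out : 𝔇.IsDef P

/-- The graph of the function `f` belongs to the system `𝔇`. -/
class IsDefinableFun (𝔇 : DefinabilitySystem E) (f : (Fin n → V) → V) : Prop where
  out : IsDefinable 𝔇 fun w : Fin (n + 1) → V => w 0 = f fun i => w i.succ

/-- The graph of the binary function `F` belongs to the system `𝔇`. -/
class IsDefinableFun₂ (𝔇 : DefinabilitySystem E) (F : V → V → V) : Prop where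
  out : IsDefinableFun 𝔇 fun v : Fin 2 → V => F (v 0) (v 1)

variable {𝔇 : DefinabilitySystem E}

section Connectives

theorem IsDefinable.congr {P Q : (Fin n → V) → Prop} (h : IsDefinable 𝔇 P)
    (e : ∀ v, Q v ↔ P v) : IsDefinable 𝔇 Q := by
  rwa [show Q = P from funext fun v => propext (e v)]

variable (P Q : (Fin n → V) → Prop)

instance IsDefinable.not [h : IsDefinable 𝔇 P] : IsDefinable 𝔇 fun v => ¬ P v := ⟨𝔇.not h.out⟩

instance IsDefinable.and [h : IsDefinable 𝔇 P] [h' : IsDefinable 𝔇 Q] :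
    IsDefinable 𝔇 fun v => P v ∧ Q v := ⟨𝔇.and h.out h'.out⟩

instance IsDefinable.or [IsDefinable 𝔇 P] [IsDefinable 𝔇 Q] : IsDefinable 𝔇 fun v => P v ∨ Q v :=
  congr (P := fun v => ¬ (¬ P v ∧ ¬ Q v)) inferInstance fun v => by tauto

instance IsDefinable.imp [IsDefinable 𝔇 P] [IsDefinable 𝔇 Q] : IsDefinable 𝔇 fun v => P v → Q v :=
  congr (P := fun v => ¬ (P v ∧ ¬ Q v)) inferInstance fun v => by tauto

instance IsDefinable.iff [IsDefinable 𝔇 P] [IsDefinable 𝔇 Q] : IsDefinable 𝔇 fun v => P v ↔ Q v :=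
  congr (P := fun v => (P v → Q v) ∧ (Q v → P v)) inferInstance fun v => by tauto

end Connectives

section Quantifiers

instance IsDefinable.ex (P : (Fin n → V) → V → Prop)
    [h : IsDefinable 𝔇 (fun w : Fin (n + 1) → V => P (fun i => w i.succ) (w 0))] :
    IsDefinable 𝔇 fun v => ∃ x, P v x := ⟨𝔇.ex h.out⟩

instance IsDefinable.all (P : (Fin n → V) → V → Prop)
    [IsDefinable 𝔇 (fun w : Fin (n + 1) → V => P (fun i => w i.succ) (w 0))] :
    IsDefinable 𝔇 fun v => ∀ x, P v x :=
  congr (P := fun v => ¬ ∃ x, ¬ P v x) inferInstance fun v => by simp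

end Quantifiers

section Substitution

instance IsDefinableFun.var (i : Fin n) : IsDefinableFun 𝔇 fun v => v i := ⟨⟨𝔇.eq 0 i.succ⟩⟩

instance (priority := 10) IsDefinableFun.subst {m : ℕ} (f : (Fin n → V) → V) (σ : Fin n → Fin m)
    [h : IsDefinableFun 𝔇 f] : IsDefinableFun 𝔇 fun w : Fin m → V => f fun i => w (σ i) := by
  refine ⟨⟨?_⟩⟩
  have := 𝔇.subst (m := m + 1) (Fin.cons 0 fun i => (σ i).succ) h.out.out
  simpa using this

theorem IsDefinable.bind (f : (Fin n → V) → V) (P : (Fin n → V) → V → Prop)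
    [h : IsDefinableFun 𝔇 f]
    [IsDefinable 𝔇 (fun w : Fin (n + 1) → V => P (fun i => w i.succ) (w 0))] :
    IsDefinable 𝔇 fun v => P v (f v) := by
  have := h.out
  exact congr (P := fun v => ∃ x, x = f v ∧ P v x) inferInstance fun v => by simp

theorem IsDefinable.comp₁ (R : V → Prop) (h : IsDefinable 𝔇 fun v : Fin 1 → V => R (v 0))
    (f : (Fin n → V) → V) [IsDefinableFun 𝔇 f] : IsDefinable 𝔇 fun v => R (f v) := by
  have : IsDefinable 𝔇 fun w : Fin (n + 1) → V => R (w 0) := ⟨𝔇.subst (fun _ => 0) h.out⟩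
  exact bind f fun _ x => R x

theorem IsDefinable.comp₂ (R : V → V → Prop)
    (h : IsDefinable 𝔇 fun v : Fin 2 → V => R (v 0) (v 1))
    (f g : (Fin n → V) → V) [IsDefinableFun 𝔇 f] [IsDefinableFun 𝔇 g] :
    IsDefinable 𝔇 fun v => R (f v) (g v) := by
  have : IsDefinable 𝔇 fun w : Fin (n + 2) → V => R (w (Fin.succ 0)) (w 0) :=
    ⟨𝔇.subst ![Fin.succ 0, 0] h.out⟩
  have : IsDefinable 𝔇 fun w : Fin (n + 1) → V => R (w 0) (g fun i => w i.succ) :=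
    bind (fun w : Fin (n + 1) → V => g fun i => w i.succ) fun w x => R (w 0) x
  exact bind f fun v x => R x (g v)

theorem IsDefinable.comp₃ (R : V → V → V → Prop)
    (h : IsDefinable 𝔇 fun v : Fin 3 → V => R (v 0) (v 1) (v 2)) (f₁ f₂ f₃ : (Fin n → V) → V)
    [IsDefinableFun 𝔇 f₁] [IsDefinableFun 𝔇 f₂] [IsDefinableFun 𝔇 f₃] :
    IsDefinable 𝔇 fun v => R (f₁ v) (f₂ v) (f₃ v) := by
  have : IsDefinable 𝔇 fun w : Fin (n + 3) → V =>
      R (w (Fin.succ (Fin.succ 0))) (w (Fin.succ 0)) (w 0) :=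
    ⟨𝔇.subst ![Fin.succ (Fin.succ 0), Fin.succ 0, 0] h.out⟩
  have : IsDefinable 𝔇 fun w : Fin (n + 2) → V =>
      R (w (Fin.succ 0)) (w 0) (f₃ fun i => w i.succ.succ) :=
    bind (fun w : Fin (n + 2) → V => f₃ fun i => w i.succ.succ)
      fun w x => R (w (Fin.succ 0)) (w 0) x
  have : IsDefinable 𝔇 fun w : Fin (n + 1) → V =>
      R (w 0) (f₂ fun i => w i.succ) (f₃ fun i => w i.succ) :=
    bind (fun w : Fin (n + 1) → V => f₂ fun i => w i.succ)
      fun w x => R (w 0) x (f₃ fun i => w i.succ)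
  exact bind f₁ fun v x => R x (f₂ v) (f₃ v)

theorem IsDefinableFun.comp₁ (F : V → V) (h : IsDefinableFun 𝔇 fun v : Fin 1 → V => F (v 0))
    (f : (Fin n → V) → V) [IsDefinableFun 𝔇 f] : IsDefinableFun 𝔇 fun v => F (f v) :=
  ⟨IsDefinable.comp₂ (fun x y => x = F y) h.out _ fun w => f fun i => w i.succ⟩

variable (f g : (Fin n → V) → V) [IsDefinableFun 𝔇 f] [hg : IsDefinableFun 𝔇 g]

instance (priority := 20) IsDefinableFun₂.comp (F : V → V → V) [h : IsDefinableFun₂ 𝔇 F] :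
    IsDefinableFun 𝔇 fun v => F (f v) (g v) :=
  ⟨IsDefinable.comp₃ (fun x y z => x = F y z) h.out.out _ (fun w => f fun i => w i.succ)
    fun w => g fun i => w i.succ⟩

instance IsDefinable.eq : IsDefinable 𝔇 fun v => f v = g v :=
  comp₂ (fun x y => x = y) ⟨𝔇.eq 0 1⟩ f g

instance IsDefinable.mem : IsDefinable 𝔇 fun v => E (f v) (g v) :=
  comp₂ E ⟨𝔇.mem 0 1⟩ f g

instance IsDefinable.isTransSet : IsDefinable 𝔇 fun v => IsTransSet E (f v) := by
  unfold IsTransSet; infer_instance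

instance IsDefinable.isOrd : IsDefinable 𝔇 fun v => IsOrd E (f v) := by
  unfold IsOrd; infer_instance

end Substitution

section Finite

instance IsDefinable.const (p : Prop) : IsDefinable 𝔇 fun _ : Fin n → V => p := by
  by_cases hp : p
  · exact congr (P := fun _ => ∀ x : V, x = x) inferInstance fun _ => by simp [hp]
  · exact congr (P := fun _ => ¬ ∀ x : V, x = x) inferInstance fun _ => by simp [hp]

instance (priority := low) IsDefinable.exFinite {ι : Type*} [Finite ι]
    (P : ι → (Fin n → V) → Prop) [∀ i, IsDefinable 𝔇 (P i)] :
    IsDefinable 𝔇 fun v => ∃ i, P i v := by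
  suffices h : ∀ {k : ℕ} (Q : Fin k → (Fin n → V) → Prop) [∀ i, IsDefinable 𝔇 (Q i)],
      IsDefinable 𝔇 fun v => ∃ i, Q i v by
    obtain ⟨k, ⟨e⟩⟩ := Finite.exists_equiv_fin ι
    exact (h fun i => P (e.symm i)).congr fun _ => e.exists_congr_left
  intro k Q _
  induction k with
  | zero => exact congr (P := fun _ => False) inferInstance fun v => by simp
  | succ k ih =>
    have := ih fun i => Q i.succ
    exact congr (P := fun v => Q 0 v ∨ ∃ i : Fin k, Q i.succ v) inferInstance fun v =>
      Fin.exists_fin_succ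

end Finite

section Relativization

theorem IsDefinable.forall_mem_class {M : Set V}
    (hM : IsDefinable 𝔇 fun v : Fin 1 → V => v 0 ∈ M) :
    IsDefinable 𝔇 fun v : Fin n → V => ∀ i, v i ∈ M := by
  have (i : Fin n) : IsDefinable 𝔇 fun v : Fin n → V => v i ∈ M := comp₁ (· ∈ M) hM _
  exact congr (P := fun v => ¬ ∃ i, ¬ v i ∈ M) inferInstance fun v => by simp

/-- The relations on a class `M` that belong to `𝔇` as relations on `V`. -/
def DefinabilitySystem.relativize (𝔇 : DefinabilitySystem E) {M : Set V}
    (hM : IsDefinable 𝔇 fun v : Fin 1 → V => v 0 ∈ M) : DefinabilitySystem (restrict E M) :=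
  have hM' : ∀ {n : ℕ}, IsDefinable 𝔇 fun v : Fin n → V => ∀ i, v i ∈ M := hM.forall_mem_class
  { IsDef := fun {n} P => 𝔇.IsDef fun v : Fin n → V => ∃ h : ∀ i, v i ∈ M, P fun i => ⟨v i, h i⟩
    mem := fun {n} i j =>
      (IsDefinable.congr (P := fun v : Fin n → V => (∀ i, v i ∈ M) ∧ E (v i) (v j))
        inferInstance fun v => by simp [restrict]).out
    eq := fun {n} i j =>
      (IsDefinable.congr (P := fun v : Fin n → V => (∀ i, v i ∈ M) ∧ v i = v j)
        inferInstance fun v => by simp).out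
    not := fun {n P} h => by
      have := IsDefinable.mk h
      exact (IsDefinable.congr (P := fun v : Fin n → V => (∀ i, v i ∈ M) ∧
        ¬ ∃ h : ∀ i, v i ∈ M, P fun i => ⟨v i, h i⟩) inferInstance fun v => by
          by_cases h : ∀ i, v i ∈ M <;> simp [h]).out
    and := fun {n P Q} h h' => by
      have := IsDefinable.mk h
      have := IsDefinable.mk h'
      exact (IsDefinable.congr (P := fun v : Fin n → V =>
        (∃ h : ∀ i, v i ∈ M, P fun i => ⟨v i, h i⟩) ∧ ∃ h : ∀ i, v i ∈ M, Q fun i => ⟨v i, h i⟩)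
          inferInstance fun v => by by_cases h : ∀ i, v i ∈ M <;> simp [h]).out
    ex := fun {n P} h => by
      have := IsDefinable.congr (IsDefinable.mk h) (Q := fun w : Fin (n + 1) → V =>
        ∃ h0 : w 0 ∈ M, ∃ h : ∀ i : Fin n, w i.succ ∈ M, P (fun i => ⟨w i.succ, h i⟩) ⟨w 0, h0⟩)
          fun w => ⟨fun ⟨h0, h, h'⟩ => ⟨Fin.cases h0 h, h'⟩,
            fun ⟨h, h'⟩ => ⟨h 0, fun i => h i.succ, h'⟩⟩
      exact (IsDefinable.congr (P := fun v : Fin n → V =>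
        ∃ x, ∃ h0 : x ∈ M, ∃ h : ∀ i, v i ∈ M, P (fun i => ⟨v i, h i⟩) ⟨x, h0⟩) ⟨𝔇.ex this.out⟩
          fun v => ⟨fun ⟨h, ⟨x, h0⟩, h'⟩ => ⟨x, h0, h, h'⟩,
            fun ⟨x, h0, h, h'⟩ => ⟨h, ⟨x, h0⟩, h'⟩⟩).out
    subst := fun {n m} σ P h => by
      have := IsDefinable.mk (𝔇.subst σ h)
      exact (IsDefinable.congr (P := fun v : Fin m → V => (∀ i, v i ∈ M) ∧
        ∃ h : ∀ i, v (σ i) ∈ M, P fun i => ⟨v (σ i), h i⟩) inferInstance fun v =>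
          ⟨fun ⟨h, h'⟩ => ⟨h, fun i => h _, h'⟩, fun ⟨h, _, h'⟩ => ⟨h, h'⟩⟩).out }

theorem IsDefinable.of_relativize {M : Set V}
    (hM : IsDefinable 𝔇 fun v : Fin 1 → V => v 0 ∈ M) {R : M → M → Prop}
    (hR : IsDefinable (𝔇.relativize hM) fun v : Fin 2 → M => R (v 0) (v 1)) :
    IsDefinable 𝔇 fun v : Fin 2 → V =>
      ∃ (h : v 0 ∈ M) (h' : v 1 ∈ M), R ⟨v 0, h⟩ ⟨v 1, h'⟩ :=
  congr ⟨hR.out⟩ fun _ =>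
    ⟨fun ⟨h, h', hv⟩ => ⟨Fin.forall_fin_two.2 ⟨h, h'⟩, hv⟩, fun ⟨h, hv⟩ => ⟨h 0, h 1, hv⟩⟩

end Relativization

section Languages

variable (L : FirstOrder.Language.{0, 0}) [L.Structure V] (A : Set V)

/-- The relations that are definable from parameters in `A` by formulas of a language that
expresses membership. -/
def DefinabilitySystem.ofLanguage (h : A.Definable L {v : Fin 2 → V | E (v 0) (v 1)}) :
    DefinabilitySystem E where
  IsDef P := A.Definable L {v | P v}
  mem i j := h.preimage_comp ![i, j]
  eq i j := ⟨(Term.var i).equal (Term.var j), by ext; simp⟩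
  not h := h.compl
  and h h' := h.inter h'
  ex {n P} h := by
    convert h.image_comp Fin.succ using 1
    ext v
    simp only [mem_ofPred_eq, mem_image]
    refine ⟨fun ⟨x, hx⟩ => ⟨Fin.cons x v, by simpa using hx, by ext i; simp⟩, ?_⟩
    rintro ⟨w, hw, rfl⟩
    exact ⟨w 0, hw⟩
  subst σ P h := h.preimage_comp σ

theorem isDefinableFun_ofLanguage_const {h : A.Definable L {v : Fin 2 → V | E (v 0) (v 1)}}
    {a : V} (ha : a ∈ A) :
    IsDefinableFun (DefinabilitySystem.ofLanguage (E := E) L A h) fun _ : Fin n → V => a :=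
  ⟨⟨(Definable.singleton_of_mem L ha).preimage_comp fun _ : Fin 1 => (0 : Fin (n + 1))⟩⟩

theorem definable_mem : letI := memStructure E
    A.Definable langMem {v : Fin 2 → V | E (v 0) (v 1)} :=
  letI := memStructure E
  ⟨Relations.formula₂ (L := langMem[[A]]) (Sum.inl MemRel.mem) (Term.var 0) (Term.var 1), by
    ext v; simp; rfl⟩

variable (E) in
/-- The relations that are definable in `(V, E)` from parameters in `A`. -/
def paramSys : DefinabilitySystem E :=
  letI := memStructure E
  .ofLanguage langMem A (definable_mem A)

variable (E) in
/-- The relations that are definable in `(V, E)` from arbitrary parameters. -/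
def fullSys : DefinabilitySystem E := paramSys E univ

theorem isDefinableFun_paramSys_const {a : V} (ha : a ∈ A) :
    IsDefinableFun (paramSys E A) fun _ : Fin n → V => a :=
  letI := memStructure E
  isDefinableFun_ofLanguage_const langMem A ha

variable (M : Set V)

theorem definable_mem_memPred : letI := memPredStructure E M
    A.Definable langMemPred {v : Fin 2 → V | E (v 0) (v 1)} :=
  letI := memPredStructure E M
  ⟨Relations.formula₂ (L := langMemPred[[A]]) (Sum.inl MemPredRel.mem) (Term.var 0) (Term.var 1),
    by ext v; simp; rfl⟩

variable (E) in
/-- The relations that are definable in `(V, E, M)` from arbitrary parameters. -/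
def predSys : DefinabilitySystem E :=
  letI := memPredStructure E M
  .ofLanguage langMemPred univ (definable_mem_memPred univ M)

theorem isDefinable_predSys_pred : IsDefinable (predSys E M) fun v : Fin 1 → V => v 0 ∈ M :=
  letI := memPredStructure E M
  ⟨⟨Relations.formula₁ (L := langMemPred[[(univ : Set V)]]) (Sum.inl MemPredRel.pred) (Term.var 0),
    by ext v; simp; rfl⟩⟩

theorem isDefinable_realize {α : Type*} (v : α → V) (φ : langMem.BoundedFormula α n) :
    letI := memStructure E
    IsDefinable (fullSys E) fun xs => φ.Realize v xs := by
  let := memStructure E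
  refine ⟨show (univ : Set V).Definable langMem _ from definable_iff_exists_formula_sum.2
    ⟨φ.toFormula.relabel (Sum.map (fun a => ⟨v a, mem_univ _⟩) id), ?_⟩⟩
  ext xs
  simp only [mem_ofPred_eq, Formula.realize_relabel, BoundedFormula.realize_toFormula]
  rfl

end Languages

end Definability

/-! ### Sets and classes -/

section Sets

variable {V : Type*} {E : V → V → Prop} {n : ℕ} {𝔇 : DefinabilitySystem E}

/-- The system `𝔇` contains all constants, and replacement holds for the relations in `𝔇`. -/
class HasReplacement (𝔇 : DefinabilitySystem E) : Prop where
  const : ∀ (n : ℕ) (a : V), IsDefinableFun 𝔇 fun _ : Fin n → V => a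
  replacement : ∀ R : V → V → Prop, IsDefinable 𝔇 (fun v : Fin 2 → V => R (v 0) (v 1)) →
    ∀ a, (∀ x, E x a → ∀ y y', R x y → R x y' → y = y') →
      ∃ b, ∀ y, E y b ↔ ∃ x, E x a ∧ R x y

instance HasReplacement.isDefinableFun_const [h : HasReplacement 𝔇] (a : V) :
    IsDefinableFun 𝔇 fun _ : Fin n → V => a :=
  h.const n a

theorem IsInnerModel.hasReplacement {M : Set V} (hM : IsInnerModel E M) :
    HasReplacement (predSys E M) where
  const _ a :=
    let := memPredStructure E M
    isDefinableFun_ofLanguage_const langMemPred univ (mem_univ a)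
  replacement R hR a ha :=
    let := memPredStructure E M
    hM.isClass.replacement {p | R p.1 p.2} hR.out a ha

variable (E) in
/-- The class `Φ` is a set. -/
def IsSet (Φ : V → Prop) : Prop := ∃ y, ∀ z, E z y ↔ Φ z

theorem isSet_sep (𝔇 : DefinabilitySystem E) [HasReplacement 𝔇] (x : V) (Φ : V → Prop)
    [IsDefinable 𝔇 fun v : Fin 1 → V => Φ (v 0)] : IsSet E fun z => E z x ∧ Φ z := by
  have : IsDefinable 𝔇 fun v : Fin 2 → V => Φ (v 0) := IsDefinable.comp₁ Φ inferInstance _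
  obtain ⟨b, hb⟩ := HasReplacement.replacement (𝔇 := 𝔇) (fun y z => y = z ∧ Φ y) inferInstance x
    (by rintro _ _ _ _ ⟨rfl, _⟩ ⟨rfl, _⟩; rfl)
  exact ⟨b, fun z => (hb z).trans
    ⟨by rintro ⟨y, hy, rfl, h⟩; exact ⟨hy, h⟩, fun ⟨h, h'⟩ => ⟨z, h, rfl, h'⟩⟩⟩

variable [hE : Fact (SatisfiesZF E)]

theorem satisfiesZFIn : @SatisfiesZFIn V langMem (memStructure E) E := hE.out

instance hasReplacement_fullSys : HasReplacement (fullSys E) where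
  const _ a := isDefinableFun_paramSys_const univ (mem_univ a)
  replacement R hR a ha :=
    let := memStructure E
    satisfiesZFIn.replacement {p | R p.1 p.2} hR.out a ha

theorem isSet_image (x : V) (f : V → V)
    [hf : IsDefinableFun (fullSys E) fun v : Fin 1 → V => f (v 0)] :
    IsSet E fun z => ∃ y, E y x ∧ z = f y :=
  HasReplacement.replacement (𝔇 := fullSys E) (fun y z => z = f y)
    ⟨(fullSys E).subst ![1, 0] hf.out.out⟩ x fun _ _ _ _ h h' => h.trans h'.symm

theorem ext_mem (E : V → V → Prop) [Fact (SatisfiesZF E)] {x y : V}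
    (h : ∀ z, E z x ↔ E z y) : x = y :=
  let := memStructure E
  satisfiesZFIn.extensionality x y h

theorem exists_minimal {x : V} (h : ∃ y, E y x) : ∃ y, E y x ∧ ∀ z, E z y → ¬ E z x :=
  let := memStructure E
  satisfiesZFIn.foundation x h

theorem exists_empty (E : V → V → Prop) [Fact (SatisfiesZF E)] : ∃ e, ∀ z, ¬ E z e :=
  let := memStructure E
  have ⟨_, ⟨e, _, he⟩, _⟩ := satisfiesZFIn (E := E).infinity
  ⟨e, he⟩

variable (E)

/-- The empty set. -/
noncomputable def emp : V := (exists_empty E).choose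

open Classical in
/-- The set of all `z` with `Φ z`, or the empty set if the class `Φ` is not a set. -/
noncomputable def mkSet (Φ : V → Prop) : V := if h : IsSet E Φ then h.choose else emp E

/-- The only element of `V` with the property `P`. As a set it is the union of the class `P`, which
makes its definability an instance of that of `mkSet`. -/
noncomputable def the (P : V → Prop) : V := mkSet E fun z => ∃ y, P y ∧ E z y

/-- The unordered pair `{a, b}`. -/
noncomputable def upair (a b : V) : V := mkSet E fun z => z = a ∨ z = b

/-- Kuratowski's ordered pair. -/
noncomputable def opair (a b : V) : V := upair E (upair E a a) (upair E a b)

/-- The union of the elements of `x`. -/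
noncomputable def sUnion (x : V) : V := mkSet E fun z => ∃ y, E y x ∧ E z y

/-- The union `x ∪ y`. -/
noncomputable def union (x y : V) : V := mkSet E fun z => E z x ∨ E z y

/-- The difference `x \ y`. -/
noncomputable def diff (x y : V) : V := mkSet E fun z => E z x ∧ ¬ E z y

/-- The power set. -/
noncomputable def powerset (x : V) : V := mkSet E fun z => ∀ y, E y z → E y x

/-- The successor `x ∪ {x}`. -/
noncomputable def succ (x : V) : V := mkSet E fun z => E z x ∨ z = x

/-- The Cartesian product `x × y`. -/
noncomputable def prod (x y : V) : V := mkSet E fun q => ∃ a b, E a x ∧ E b y ∧ q = opair E a b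

/-- The domain of the relation `r`. -/
noncomputable def dom (r : V) : V := mkSet E fun a => ∃ b, E (opair E a b) r

/-- The range of the relation `r`. -/
noncomputable def ran (r : V) : V := mkSet E fun b => ∃ a, E (opair E a b) r

variable {E}

theorem not_mem_emp (z : V) : ¬ E z (emp E) := (exists_empty E).choose_spec z

theorem eq_emp_iff {x : V} : x = emp E ↔ ∀ z, ¬ E z x :=
  ⟨by rintro rfl; exact not_mem_emp,
    fun h => ext_mem E fun z => iff_of_false (h z) (not_mem_emp z)⟩

theorem mem_mkSet {Φ : V → Prop} (h : IsSet E Φ) {z : V} : E z (mkSet E Φ) ↔ Φ z := by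
  rw [mkSet, dif_pos h]; exact h.choose_spec z

theorem mem_mkSet_of_subset (x : V) {Φ : V → Prop}
    [IsDefinable (fullSys E) fun v : Fin 1 → V => Φ (v 0)] (h : ∀ z, Φ z → E z x) {z : V} :
    E z (mkSet E Φ) ↔ Φ z := by
  obtain ⟨y, hy⟩ := isSet_sep (fullSys E) x Φ
  exact mem_mkSet ⟨y, fun z => (hy z).trans (and_iff_right_of_imp (h z))⟩

theorem eq_mkSet_iff {Φ : V → Prop} {x : V} : x = mkSet E Φ ↔
    (∀ z, E z x ↔ Φ z) ∨ ((¬ ∃ y, ∀ z, E z y ↔ Φ z) ∧ ∀ z, ¬ E z x) := by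
  by_cases h : IsSet E Φ
  · have (z : V) : Φ z ↔ E z (mkSet E Φ) := (mem_mkSet h).symm
    rw [or_iff_left fun h' => h'.1 h]
    exact ⟨by rintro rfl z; exact mem_mkSet h, fun h' => ext_mem E fun z => (h' z).trans (this z)⟩
  · rw [or_iff_right fun h' => h ⟨x, h'⟩, mkSet, dif_neg h, eq_emp_iff]
    exact (and_iff_right h).symm

theorem the_eq {P : V → Prop} {y : V} (h : P y) (h' : ∀ z, P z → z = y) : the E P = y := by
  have (z : V) : E z y ↔ ∃ y, P y ∧ E z y :=
    ⟨fun hz => ⟨y, h, hz⟩, fun ⟨x, hx, hz⟩ => h' x hx ▸ hz⟩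
  exact ext_mem E fun z => (mem_mkSet ⟨y, this⟩).trans (this z).symm

theorem the_eq_emp {P : V → Prop} (h : ∀ y, ¬ P y) : the E P = emp E :=
  have : ∀ z, E z (emp E) ↔ ∃ y, P y ∧ E z y := fun z => by simp [h, not_mem_emp]
  eq_emp_iff.2 fun z hz => not_mem_emp z ((this z).2 ((mem_mkSet ⟨_, this⟩).1 hz))

theorem mem_upair {a b z : V} : E z (upair E a b) ↔ z = a ∨ z = b :=
  let := memStructure E
  mem_mkSet (satisfiesZFIn.pairing a b)

theorem mem_sUnion {x z : V} : E z (sUnion E x) ↔ ∃ y, E y x ∧ E z y :=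
  let := memStructure E
  mem_mkSet (satisfiesZFIn.union x)

theorem mem_powerset {x z : V} : E z (powerset E x) ↔ ∀ y, E y z → E y x :=
  let := memStructure E
  mem_mkSet (satisfiesZFIn.powerset x)

theorem mem_union {x y z : V} : E z (union E x y) ↔ E z x ∨ E z y :=
  mem_mkSet ⟨sUnion E (upair E x y), fun z => by simp [mem_sUnion, mem_upair]⟩

theorem mem_diff {x y z : V} : E z (diff E x y) ↔ E z x ∧ ¬ E z y :=
  mem_mkSet_of_subset x fun _ => And.left

theorem mem_succ {x z : V} : E z (succ E x) ↔ E z x ∨ z = x :=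
  mem_mkSet ⟨union E x (upair E x x), fun z => by simp [mem_union, mem_upair]⟩

theorem mem_succ_self (x : V) : E x (succ E x) := mem_succ.2 (.inr rfl)

theorem mem_irrefl (x : V) : ¬ E x x := fun h => by
  obtain ⟨y, hy, h'⟩ := exists_minimal (E := E) (x := upair E x x) ⟨x, mem_upair.2 (.inl rfl)⟩
  obtain rfl : y = x := by simpa [mem_upair] using hy
  exact h' y h hy

theorem isPair_iff {p a b : V} : IsPair E p a b ↔ p = upair E a b :=
  ⟨fun h => ext_mem E fun z => (h z).trans mem_upair.symm, by rintro rfl z; exact mem_upair⟩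

theorem isOrderedPair_iff {p a b : V} : IsOrderedPair E p a b ↔ p = opair E a b := by
  simp [IsOrderedPair, isPair_iff, opair]

theorem upair_inj {a b c d : V} (h : upair E a b = upair E c d) :
    a = c ∧ b = d ∨ a = d ∧ b = c := by
  have key (z : V) : z = a ∨ z = b ↔ z = c ∨ z = d := by
    rw [← mem_upair (E := E), h, mem_upair (E := E)]
  have ha := (key a).1 (.inl rfl)
  have hb := (key b).1 (.inr rfl)
  have hc := (key c).2 (.inl rfl)
  have hd := (key d).2 (.inr rfl)
  grind

theorem opair_inj {a b c d : V} : opair E a b = opair E c d ↔ a = c ∧ b = d := by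
  refine ⟨fun h => ?_, by rintro ⟨rfl, rfl⟩; rfl⟩
  rcases upair_inj h with ⟨h1, h2⟩ | ⟨h1, h2⟩ <;>
    have h1 := upair_inj h1 <;> have h2 := upair_inj h2 <;> grind

theorem mem_sUnion_sUnion_of_opair_mem {r a b : V} (h : E (opair E a b) r) :
    E a (sUnion E (sUnion E r)) ∧ E b (sUnion E (sUnion E r)) := by
  have : E (upair E a b) (sUnion E r) := mem_sUnion.2 ⟨_, h, mem_upair.2 (.inr rfl)⟩
  exact ⟨mem_sUnion.2 ⟨_, this, mem_upair.2 (.inl rfl)⟩,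
    mem_sUnion.2 ⟨_, this, mem_upair.2 (.inr rfl)⟩⟩

section Definability

instance IsDefinableFun.mkSet (Φ : (Fin n → V) → V → Prop)
    [h : IsDefinable 𝔇 fun w : Fin (n + 1) → V => Φ (fun i => w i.succ) (w 0)] :
    IsDefinableFun 𝔇 fun v => mkSet E (Φ v) := by
  refine ⟨IsDefinable.congr ?_ fun v => eq_mkSet_iff⟩
  have : IsDefinable 𝔇 (fun w : Fin (n + 2) → V => Φ (fun i => w i.succ.succ) (w 0)) :=
    ⟨𝔇.subst (Fin.cons 0 fun i => i.succ.succ) h.out⟩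
  have : IsDefinable 𝔇 (fun w : Fin (n + 3) → V => Φ (fun i => w i.succ.succ.succ) (w 0)) :=
    ⟨𝔇.subst (Fin.cons 0 fun i => i.succ.succ.succ) h.out⟩
  infer_instance

instance IsDefinableFun.the (P : (Fin n → V) → V → Prop)
    [h : IsDefinable 𝔇 fun w : Fin (n + 1) → V => P (fun i => w i.succ) (w 0)] :
    IsDefinableFun 𝔇 fun v => the E (P v) := by
  have : IsDefinable 𝔇 (fun w : Fin (n + 2) → V => P (fun i => w i.succ.succ) (w 0)) :=
    ⟨𝔇.subst (Fin.cons 0 fun i => i.succ.succ) h.out⟩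
  unfold SetModel.the; infer_instance

instance IsDefinableFun.emp : IsDefinableFun 𝔇 fun _ : Fin n → V => emp E :=
  ⟨IsDefinable.congr (P := fun w : Fin (n + 1) → V => ∀ z, ¬ E z (w 0)) inferInstance
    fun _ => eq_emp_iff⟩

variable (f : (Fin n → V) → V) [IsDefinableFun 𝔇 f]

instance IsDefinableFun.sUnion : IsDefinableFun 𝔇 fun v => sUnion E (f v) := by
  unfold SetModel.sUnion; infer_instance

instance IsDefinableFun.succ : IsDefinableFun 𝔇 fun v => succ E (f v) := by
  unfold SetModel.succ; infer_instance

section Binary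

variable (g : (Fin n → V) → V) [IsDefinableFun 𝔇 g]

instance IsDefinableFun.upair : IsDefinableFun 𝔇 fun v => upair E (f v) (g v) := by
  unfold SetModel.upair; infer_instance

instance IsDefinableFun.opair : IsDefinableFun 𝔇 fun v => opair E (f v) (g v) := by
  unfold SetModel.opair; infer_instance

instance IsDefinableFun.union : IsDefinableFun 𝔇 fun v => union E (f v) (g v) := by
  unfold SetModel.union; infer_instance

instance IsDefinableFun.diff : IsDefinableFun 𝔇 fun v => diff E (f v) (g v) := by
  unfold SetModel.diff; infer_instance

instance IsDefinableFun.prod : IsDefinableFun 𝔇 fun v => prod E (f v) (g v) := by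
  unfold SetModel.prod; infer_instance

end Binary

instance IsDefinableFun.dom : IsDefinableFun 𝔇 fun v => dom E (f v) := by
  unfold SetModel.dom; infer_instance

instance IsDefinableFun.ran : IsDefinableFun 𝔇 fun v => ran E (f v) := by
  unfold SetModel.ran; infer_instance

end Definability

theorem mem_prod {x y q : V} :
    E q (prod E x y) ↔ ∃ a b, E a x ∧ E b y ∧ q = opair E a b :=
  mem_mkSet_of_subset (powerset E (powerset E (union E x y))) fun q ⟨a, b, ha, hb, hq⟩ => by
    subst hq
    simp only [mem_powerset, opair, mem_upair, mem_union]
    rintro s (rfl | rfl) z hz <;> rcases mem_upair.1 hz with rfl | rfl <;> simp [ha, hb]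

theorem opair_mem_prod {x y a b : V} : E (opair E a b) (prod E x y) ↔ E a x ∧ E b y := by
  simp [mem_prod, opair_inj]

theorem mem_dom {r a : V} : E a (dom E r) ↔ ∃ b, E (opair E a b) r :=
  mem_mkSet_of_subset (sUnion E (sUnion E r)) fun _ ⟨_, h⟩ => (mem_sUnion_sUnion_of_opair_mem h).1

theorem mem_ran {r b : V} : E b (ran E r) ↔ ∃ a, E (opair E a b) r :=
  mem_mkSet_of_subset (sUnion E (sUnion E r)) fun _ ⟨_, h⟩ => (mem_sUnion_sUnion_of_opair_mem h).2

end Sets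

/-! ### Ordinals -/

section Ordinals

variable {V : Type*} {E : V → V → Prop} {n : ℕ} {𝔇 : DefinabilitySystem E}

theorem IsOrd.mem {a x : V} (ha : IsOrd E a) (h : E x a) : IsOrd E x :=
  ⟨ha.2 x h, fun y hy => ha.2 y (ha.1 x h y hy)⟩

theorem IsOrd.trans {a x y : V} (ha : IsOrd E a) (h : E x a) (h' : E y x) : E y a := ha.1 x h y h'

theorem isOrd_of_isTransSet {a : V} (h : IsTransSet E a) (h' : ∀ x, E x a → IsOrd E x) :
    IsOrd E a :=
  ⟨h, fun x hx => (h' x hx).1⟩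

variable (E) in
/-- `a` is the least ordinal in the class `P`. -/
def IsLeastOrd (P : V → Prop) (a : V) : Prop := IsOrd E a ∧ P a ∧ ∀ b, E b a → ¬ P b

instance IsDefinable.isLeastOrd (P : (Fin n → V) → V → Prop) (f : (Fin n → V) → V)
    [IsDefinableFun 𝔇 f] [IsDefinable 𝔇 fun w : Fin (n + 1) → V => P (fun i => w i.succ) (w 0)] :
    IsDefinable 𝔇 fun v => IsLeastOrd E (P v) (f v) := by
  have := bind f P (𝔇 := 𝔇)
  unfold IsLeastOrd; infer_instance

variable [Fact (SatisfiesZF E)]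

theorem exists_isLeastOrd (𝔇 : DefinabilitySystem E) [HasReplacement 𝔇] (P : V → Prop)
    [IsDefinable 𝔇 fun v : Fin 1 → V => P (v 0)] {a : V} (ha : IsOrd E a) (h : P a) :
    ∃ b, IsLeastOrd E P b := by
  by_cases h' : ∃ x, E x a ∧ P x
  · obtain ⟨c, hc⟩ := isSet_sep 𝔇 a P
    obtain ⟨y, hy, hy'⟩ := exists_minimal (E := E) (x := c) (by simpa [hc] using h')
    have hy := (hc y).1 hy
    exact ⟨y, ha.mem hy.1, hy.2, fun b hb hP => hy' b hb ((hc b).2 ⟨ha.trans hy.1 hb, hP⟩)⟩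
  · exact ⟨a, ha, h, fun b hb hP => h' ⟨b, hb, hP⟩⟩

theorem ord_induction (P : V → Prop) [IsDefinable (fullSys E) fun v : Fin 1 → V => P (v 0)]
    (h : ∀ a, IsOrd E a → (∀ b, E b a → P b) → P a) {a : V} (ha : IsOrd E a) : P a := by
  by_contra hP
  obtain ⟨b, hb, hb', hb''⟩ := exists_isLeastOrd (fullSys E) (fun x => ¬ P x) ha hP
  exact hb' (h b hb fun c hc => by_contra (hb'' c hc))

theorem IsOrd.trichotomy {a b : V} (ha : IsOrd E a) (hb : IsOrd E b) : E a b ∨ a = b ∨ E b a := by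
  refine ord_induction (fun a => ∀ b, IsOrd E b → E a b ∨ a = b ∨ E b a) ?_ ha b hb
  intro a ha iha b hb
  refine ord_induction (fun b => E a b ∨ a = b ∨ E b a) ?_ hb
  intro b hb ihb
  by_cases h1 : ∃ y, E y b ∧ (E a y ∨ a = y)
  · obtain ⟨y, hy, h | rfl⟩ := h1
    · exact .inl (hb.trans hy h)
    · exact .inl hy
  by_cases h2 : ∃ x, E x a ∧ (E b x ∨ b = x)
  · obtain ⟨x, hx, h | rfl⟩ := h2
    · exact .inr (.inr (ha.trans hx h))
    · exact .inr (.inr hx)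
  refine .inr (.inl (ext_mem E fun z => ⟨fun hz => ?_, fun hz => ?_⟩))
  · have := iha z hz b hb
    grind
  · have := ihb z hz
    grind

theorem IsOrd.mem_succ_or_mem {a b : V} (ha : IsOrd E a) (hb : IsOrd E b) :
    E a (succ E b) ∨ E b a :=
  (or_congr_left mem_succ).2 (or_assoc.2 (ha.trichotomy hb))

theorem IsLeastOrd.unique {P : V → Prop} {a b : V} (ha : IsLeastOrd E P a)
    (hb : IsLeastOrd E P b) : a = b := by
  rcases ha.1.trichotomy hb.1 with h | h | h
  · exact (hb.2.2 a h ha.2.1).elim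
  · exact h
  · exact (ha.2.2 b h hb.2.1).elim

theorem isOrd_emp : IsOrd E (emp E) :=
  ⟨fun x hx => (not_mem_emp x hx).elim, fun x hx => (not_mem_emp x hx).elim⟩

theorem IsOrd.succ {a : V} (ha : IsOrd E a) : IsOrd E (succ E a) := by
  refine isOrd_of_isTransSet (fun x hx y hy => mem_succ.2 (.inl ?_)) fun x hx => ?_ <;>
    rcases mem_succ.1 hx with hx | rfl
  exacts [ha.trans hx hy, hy, ha.mem hx, ha]

theorem isOrd_sUnion {x : V} (h : ∀ y, E y x → IsOrd E y) : IsOrd E (sUnion E x) := by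
  refine isOrd_of_isTransSet (fun z hz u hu => ?_) fun z hz => ?_ <;>
    obtain ⟨y, hy, hz⟩ := mem_sUnion.1 hz
  exacts [mem_sUnion.2 ⟨y, hy, (h y hy).trans hz hu⟩, (h y hy).mem hz]

theorem exists_ord_bound (x : V) : ∃ l, IsOrd E l ∧ ∀ a, IsOrd E a → E a x → E a l := by
  obtain ⟨y, hy⟩ := isSet_sep (fullSys E) x (IsOrd E)
  have hU : IsOrd E (sUnion E y) := isOrd_sUnion fun z hz => ((hy z).1 hz).2
  exact ⟨_, hU.succ, fun a ha hax => (ha.mem_succ_or_mem hU).resolve_right fun h =>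
    mem_irrefl _ (mem_sUnion.2 ⟨a, (hy a).2 ⟨hax, ha⟩, h⟩)⟩

theorem exists_isOrd_not_mem (x : V) : ∃ a, IsOrd E a ∧ ¬ E a x := by
  obtain ⟨l, hl, h⟩ := exists_ord_bound (E := E) x
  exact ⟨l, hl, fun hx => mem_irrefl l (h l hl hx)⟩

theorem collection (𝔇 : DefinabilitySystem E) [HasReplacement 𝔇] (R : V → V → Prop)
    [IsDefinable 𝔇 fun v : Fin 2 → V => R (v 0) (v 1)] (x : V)
    (h : ∀ y, E y x → ∃ a, IsOrd E a ∧ R y a) :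
    ∃ l, IsOrd E l ∧ ∀ y, E y x → ∃ a, E a l ∧ R y a := by
  have {n : ℕ} (f g : (Fin n → V) → V) [IsDefinableFun 𝔇 f] [IsDefinableFun 𝔇 g] :
      IsDefinable 𝔇 fun v => R (f v) (g v) := IsDefinable.comp₂ R inferInstance f g
  obtain ⟨b, hb⟩ := HasReplacement.replacement (𝔇 := 𝔇) (fun y a => IsLeastOrd E (R y) a)
    inferInstance x fun y _ _ _ h h' => h.unique h'
  obtain ⟨l, hl, hl'⟩ := exists_ord_bound (E := E) b
  refine ⟨l, hl, fun y hy => ?_⟩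
  obtain ⟨a, ha, hR⟩ := h y hy
  obtain ⟨c, hc⟩ := exists_isLeastOrd 𝔇 (R y) ha hR
  exact ⟨c, hl' c hc.1 ((hb c).2 ⟨y, hy, hc⟩), hc.2.1⟩

theorem exists_mem_apply_eq (f : V → V)
    [IsDefinableFun (fullSys E) fun v : Fin 1 → V => f (v 0)] {m : V} (hm : IsOrd E m) (x : V)
    (h : ∀ a, IsOrd E a → E m a → E (f a) x) :
    ∃ a b, IsOrd E a ∧ E m b ∧ E b a ∧ f b = f a := by
  by_contra! hf
  have {n : ℕ} (g : (Fin n → V) → V) [IsDefinableFun (fullSys E) g] :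
      IsDefinableFun (fullSys E) fun v => f (g v) := IsDefinableFun.comp₁ f inferInstance g
  obtain ⟨s, hs⟩ := HasReplacement.replacement (𝔇 := fullSys E)
    (fun y a => IsOrd E a ∧ E m a ∧ y = f a) inferInstance x (by
      rintro y _ a a' ⟨ha, hma, rfl⟩ ⟨ha', hma', h⟩
      rcases ha.trichotomy ha' with h' | h' | h'
      · exact (hf a' a ha' hma h' h).elim
      · exact h'
      · exact (hf a a' ha hma' h' h.symm).elim)
  obtain ⟨a, ha, ha'⟩ := exists_isOrd_not_mem (E := E) (union E s (succ E m))
  refine ha' (mem_union.2 ((ha.mem_succ_or_mem hm).symm.imp_left fun hma => ?_))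
  exact (hs a).2 ⟨f a, h a ha hma, ha, hma, rfl⟩

variable (E) in
theorem exists_limit : ∃ l, IsOrd E l ∧ E (emp E) l ∧ ∀ x, E x l → E (succ E x) l := by
  let := memStructure E
  obtain ⟨w, ⟨e, hew, he⟩, hw⟩ := satisfiesZFIn (E := E).infinity
  obtain ⟨l, hl⟩ := isSet_sep (fullSys E) w fun x => IsOrd E x ∧ ∀ y, E y x → E y w
  have hlw {x : V} (hx : E x l) := (hl x).1 hx
  refine ⟨l, isOrd_of_isTransSet (fun x hx y hy => ?_) (fun x hx => (hlw hx).2.1), ?_, ?_⟩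
  · obtain ⟨-, hx, hxw⟩ := hlw hx
    exact (hl y).2 ⟨hxw y hy, hx.mem hy, fun z hz => hxw z (hx.trans hy hz)⟩
  · exact (hl _).2 ⟨eq_emp_iff.2 he ▸ hew, isOrd_emp, fun y hy => (not_mem_emp y hy).elim⟩
  · intro x hx
    obtain ⟨hx, hx', hxw⟩ := hlw hx
    obtain ⟨s, hs, hs'⟩ := hw x hx
    obtain rfl : s = SetModel.succ E x := ext_mem E fun z => (hs' z).trans mem_succ.symm
    refine (hl _).2 ⟨hs, hx'.succ, fun y hy => ?_⟩
    rcases mem_succ.1 hy with hy | rfl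
    exacts [hxw y hy, hx]

end Ordinals

/-! ### Recursion along the ordinals -/

section Recursion

variable {V : Type*} {E : V → V → Prop} {n : ℕ} [Fact (SatisfiesZF E)]

variable (E) in
/-- The restriction of the function `g` to the set `a`. -/
noncomputable def restr (g a : V) : V := mkSet E fun q => E q g ∧ ∃ x y, E x a ∧ q = opair E x y

theorem mem_restr {g a q : V} : E q (restr E g a) ↔ E q g ∧ ∃ x y, E x a ∧ q = opair E x y :=
  mem_mkSet_of_subset g fun _ => And.left

variable (E) (N : V → V → V)

/-- `g` is a function on `a` that satisfies the recursion equation `g(x) = N(p, g ↾ x)`. -/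
def Attempt (p a g : V) : Prop :=
  ∀ q, E q g ↔ ∃ x, E x a ∧ q = opair E x (N p (restr E g x))

/-- The function on the ordinal `a` that is defined by recursion from `N` and the parameter `p`. -/
noncomputable def hist (p a : V) : V := the E (Attempt E N p a)

/-- The value at the ordinal `a` of the function that is defined by recursion from `N` and the
parameter `p`. -/
noncomputable def ordRec (p a : V) : V := N p (hist E N p a)

variable {E}

section Definability

variable {𝔇 : DefinabilitySystem E} (f g h : (Fin n → V) → V) [IsDefinableFun 𝔇 f]
  [IsDefinableFun 𝔇 g] [IsDefinableFun 𝔇 h]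

instance IsDefinableFun.restr : IsDefinableFun 𝔇 fun v => restr E (f v) (g v) := by
  unfold SetModel.restr; infer_instance

variable [IsDefinableFun₂ 𝔇 N]

instance IsDefinable.attempt : IsDefinable 𝔇 fun v => Attempt E N (f v) (g v) (h v) := by
  unfold Attempt; infer_instance

instance IsDefinableFun.hist : IsDefinableFun 𝔇 fun v => hist E N (f v) (g v) := by
  unfold SetModel.hist; infer_instance

instance IsDefinableFun.ordRec : IsDefinableFun 𝔇 fun v => ordRec E N (f v) (g v) := by
  unfold SetModel.ordRec; infer_instance

end Definability

variable {N} {p a b g g' : V}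

namespace Attempt

theorem mem_restr_iff (hg : Attempt E N p a g) (ha : IsOrd E a) (h : E b a) {q : V} :
    E q (restr E g b) ↔ ∃ x, E x b ∧ q = opair E x (N p (restr E g x)) := by
  rw [mem_restr (E := E), hg q]
  constructor
  · rintro ⟨⟨x, -, rfl⟩, y, z, hy, h'⟩
    obtain ⟨rfl, -⟩ := opair_inj.1 h'
    exact ⟨x, hy, rfl⟩
  · rintro ⟨x, hx, rfl⟩
    exact ⟨⟨x, ha.trans h hx, rfl⟩, x, _, hx, rfl⟩

theorem restr_eq_restr (hg : Attempt E N p a g) (hg' : Attempt E N p b g') (ha : IsOrd E a)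
    (hb : IsOrd E b) {c : V} (hc : IsOrd E c) : E c a → E c b → restr E g c = restr E g' c := by
  refine ord_induction (fun c => E c a → E c b → restr E g c = restr E g' c) ?_ hc
  intro c _ ih hca hcb
  refine ext_mem E fun q => ?_
  rw [hg.mem_restr_iff ha hca, hg'.mem_restr_iff hb hcb]
  refine exists_congr fun x => and_congr_right fun hx => ?_
  rw [ih x hx (ha.trans hca hx) (hb.trans hcb hx)]

theorem unique (hg : Attempt E N p a g) (hg' : Attempt E N p a g') (ha : IsOrd E a) : g = g' := by
  refine ext_mem E fun q => ?_
  rw [hg q, hg' q]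
  refine exists_congr fun x => and_congr_right fun hx => ?_
  rw [hg.restr_eq_restr hg' ha ha (ha.mem hx) hx hx]

theorem eq_hist (hg : Attempt E N p a g) (ha : IsOrd E a) : hist E N p a = g :=
  the_eq hg fun _ hg' => hg'.unique hg ha

theorem restr_eq_hist (hg : Attempt E N p a g) (ha : IsOrd E a) (h : E b a) :
    restr E g b = hist E N p b := by
  refine (eq_hist (fun q => ?_) (ha.mem h)).symm
  rw [hg.mem_restr_iff ha h]
  refine exists_congr fun x => and_congr_right fun hx => ?_
  have : restr E (restr E g b) x = restr E g x := ext_mem E fun r => by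
    simp only [mem_restr (E := E), and_assoc]
    refine and_congr_right fun _ => ⟨And.right, ?_⟩
    rintro ⟨y, z, hy, rfl⟩
    exact ⟨⟨y, z, (ha.mem h).trans hx hy, rfl⟩, y, z, hy, rfl⟩
  rw [this]

theorem mem_iff (hg : Attempt E N p a g) (ha : IsOrd E a) {q : V} :
    E q g ↔ ∃ x, E x a ∧ q = opair E x (ordRec E N p x) := by
  rw [hg q]
  exact exists_congr fun x => and_congr_right fun hx => by rw [hg.restr_eq_hist ha hx, ordRec]

end Attempt

variable [IsDefinableFun₂ (fullSys E) N]

theorem attempt_hist (p : V) (ha : IsOrd E a) : Attempt E N p a (hist E N p a) := by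
  suffices h : ∃ g, Attempt E N p a g by
    obtain ⟨g, hg⟩ := h
    rwa [hg.eq_hist ha]
  refine ord_induction (fun a => ∃ g, Attempt E N p a g) ?_ ha
  intro a ha ih
  obtain ⟨g, hg⟩ := isSet_image (E := E) a fun x => opair E x (ordRec E N p x)
  have restr_eq {x : V} (hx : E x a) : restr E g x = hist E N p x := by
    obtain ⟨h, hh⟩ := ih x hx
    rw [hh.eq_hist (ha.mem hx)]
    refine ext_mem E fun q => ?_
    rw [hh.mem_iff (ha.mem hx), mem_restr (E := E), hg]
    constructor
    · rintro ⟨⟨y, -, rfl⟩, z, w, hz, h'⟩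
      exact ⟨y, (opair_inj.1 h').1 ▸ hz, rfl⟩
    · rintro ⟨y, hy, rfl⟩
      exact ⟨⟨y, ha.trans hx hy, rfl⟩, y, _, hy, rfl⟩
  refine ⟨g, fun q => ?_⟩
  rw [hg]
  exact exists_congr fun x => and_congr_right fun hx => by rw [restr_eq hx, ordRec]

theorem mem_ran_hist (ha : IsOrd E a) {z : V} :
    E z (ran E (hist E N p a)) ↔ ∃ b, E b a ∧ z = ordRec E N p b := by
  simp only [mem_ran, (attempt_hist p ha).mem_iff ha, opair_inj]
  exact ⟨fun ⟨_, b, hb, _, h⟩ => ⟨b, hb, h⟩, fun ⟨b, hb, h⟩ => ⟨b, b, hb, rfl, h⟩⟩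

end Recursion

/-! ### The cumulative hierarchy and transitive closures -/

section Hierarchy

variable {V : Type*} {E : V → V → Prop} {n : ℕ} {𝔇 : DefinabilitySystem E} [Fact (SatisfiesZF E)]

variable (E)

/-- The recursion step of the cumulative hierarchy: the union of the power sets of the earlier
levels. -/
noncomputable def levelStep (_ g : V) : V :=
  mkSet E fun y => ∃ b, E b (ran E g) ∧ ∀ z, E z y → E z b

/-- The level `V_a` of the cumulative hierarchy. -/
noncomputable def level (a : V) : V := ordRec E (levelStep E) (emp E) a

/-- The recursion step of the transitive closure of `p`. -/
noncomputable def tcStep (p g : V) : V := union E p (sUnion E (sUnion E (ran E g)))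

/-- The transitive closure of `{a}`. -/
noncomputable def tcl (a : V) : V := mkSet E fun z => ∀ s, IsTransSet E s → E a s → E z s

instance : IsDefinableFun₂ 𝔇 (levelStep E) := ⟨by unfold levelStep; infer_instance⟩

instance : IsDefinableFun₂ 𝔇 (tcStep E) := ⟨by unfold tcStep; infer_instance⟩

variable {E}

instance IsDefinableFun.level (f : (Fin n → V) → V) [IsDefinableFun 𝔇 f] :
    IsDefinableFun 𝔇 fun v => level E (f v) := by
  unfold SetModel.level; infer_instance

instance IsDefinableFun.tcl (f : (Fin n → V) → V) [IsDefinableFun 𝔇 f] :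
    IsDefinableFun 𝔇 fun v => tcl E (f v) := by
  unfold SetModel.tcl; infer_instance

theorem mem_level {a y : V} (ha : IsOrd E a) :
    E y (level E a) ↔ ∃ b, E b a ∧ ∀ z, E z y → E z (level E b) := by
  have mem_levelStep {p g : V} :
      E y (levelStep E p g) ↔ ∃ b, E b (ran E g) ∧ ∀ z, E z y → E z b :=
    mem_mkSet_of_subset (powerset E (sUnion E (ran E g))) fun y ⟨b, hb, hy⟩ =>
      mem_powerset.2 fun z hz => mem_sUnion.2 ⟨b, hb, hy z hz⟩
  refine (mem_levelStep (p := emp E)).trans ?_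
  simp only [mem_ran_hist ha]
  exact ⟨fun ⟨_, ⟨b, hb, rfl⟩, h⟩ => ⟨b, hb, h⟩, fun ⟨b, hb, h⟩ => ⟨_, ⟨b, hb, rfl⟩, h⟩⟩

theorem mem_level_of_mem {a b y : V} (hb : IsOrd E b) (h : E a b) (hy : E y (level E a)) :
    E y (level E b) :=
  have ⟨c, hc, hy⟩ := (mem_level (hb.mem h)).1 hy
  (mem_level hb).2 ⟨c, hb.trans h hc, hy⟩

theorem mem_level_succ {a y : V} (ha : IsOrd E a) (h : ∀ z, E z y → E z (level E a)) :
    E y (level E (succ E a)) :=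
  (mem_level ha.succ).2 ⟨a, mem_succ_self a, h⟩

theorem exists_isTransSet (a : V) : ∃ t, IsTransSet E t ∧ E a t := by
  obtain ⟨l, hl, h0, hs⟩ := exists_limit E
  have mem_tc {b z : V} (hb : IsOrd E b) : E z (ordRec E (tcStep E) a b) ↔
      E z a ∨ ∃ c y, E c b ∧ E y (ordRec E (tcStep E) a c) ∧ E z y := by
    rw [ordRec, tcStep, mem_union (E := E)]
    simp only [mem_sUnion (E := E), mem_ran_hist hb]
    exact or_congr_right ⟨fun ⟨y, ⟨_, ⟨c, hc, rfl⟩, hy⟩, hz⟩ => ⟨c, y, hc, hy, hz⟩,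
      fun ⟨c, y, hc, hy, hz⟩ => ⟨y, ⟨_, ⟨c, hc, rfl⟩, hy⟩, hz⟩⟩
  refine ⟨union E (ordRec E (tcStep E) a l) (upair E a a), fun z hz u hu => ?_,
    mem_union.2 (.inr (mem_upair.2 (.inl rfl)))⟩
  refine mem_union.2 (.inl ((mem_tc hl).2 ?_))
  rcases mem_union.1 hz with hz | hz
  · rcases (mem_tc hl).1 hz with hz | ⟨c, y, hc, hy, hz⟩
    · exact .inr ⟨_, z, h0, (mem_tc (hl.mem h0)).2 (.inl hz), hu⟩
    · exact .inr ⟨_, z, hs c hc, (mem_tc (hl.mem hc).succ).2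
        (.inr ⟨c, y, mem_succ_self c, hy, hz⟩), hu⟩
  · obtain rfl : z = a := by simpa using mem_upair.1 hz
    exact .inl hu

theorem mem_tcl {a z : V} : E z (tcl E a) ↔ ∀ s, IsTransSet E s → E a s → E z s := by
  obtain ⟨t, ht, hat⟩ := exists_isTransSet (E := E) a
  exact mem_mkSet_of_subset t fun z hz => hz t ht hat

theorem isTransSet_tcl (a : V) : IsTransSet E (tcl E a) := fun x hx y hy =>
  mem_tcl.2 fun s hs ha => hs x (mem_tcl.1 hx s hs ha) y hy

theorem mem_tcl_self (a : V) : E a (tcl E a) := mem_tcl.2 fun _ _ h => h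

theorem isTclSingleton_iff {t a : V} : IsTclSingleton E t a ↔ t = tcl E a := by
  constructor
  · intro h
    exact ext_mem E fun z => ⟨h.2 _ (isTransSet_tcl a) (mem_tcl_self a) z,
      fun hz => mem_tcl.1 hz t h.1.1 h.1.2⟩
  · rintro rfl
    exact ⟨⟨isTransSet_tcl a, mem_tcl_self a⟩, fun s hs ha x hx => mem_tcl.1 hx s hs ha⟩

theorem mem_induction (P : V → Prop) [IsDefinable (fullSys E) fun v : Fin 1 → V => P (v 0)]
    (h : ∀ a, (∀ b, E b a → P b) → P a) (a : V) : P a := by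
  by_contra hP
  obtain ⟨c, hc⟩ := isSet_sep (fullSys E) (tcl E a) fun x => ¬ P x
  obtain ⟨y, hy, hy'⟩ := exists_minimal (E := E) ⟨a, (hc a).2 ⟨mem_tcl_self a, hP⟩⟩
  obtain ⟨hy, hPy⟩ := (hc y).1 hy
  exact hPy (h y fun b hb => by_contra fun hb' =>
    hy' b hb ((hc b).2 ⟨isTransSet_tcl a y hy b hb, hb'⟩))

theorem exists_mem_level (x : V) : ∃ a, IsOrd E a ∧ E x (level E a) := by
  refine mem_induction (E := E) (fun x => ∃ a, IsOrd E a ∧ E x (level E a)) ?_ x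
  intro x ih
  obtain ⟨l, hl, h⟩ := collection (fullSys E) (fun y a => E y (level E a)) x ih
  refine ⟨_, hl.succ, mem_level_succ hl fun z hz => ?_⟩
  obtain ⟨a, ha, hz⟩ := h z hz
  exact mem_level_of_mem hl ha hz

end Hierarchy

/-! ### Enumerating the closure of an operation -/

section Enumeration

variable {V : Type*} {E : V → V → Prop} {n : ℕ} {𝔇 : DefinabilitySystem E}

variable (E) in
/-- `m` is the least strict bound of the entries of a triple of ordinals in the class `Q`, and
`(t, a, b)` is the lexicographically least triple in `Q` with entries below `m`. -/
def IsLeastTriple (Q : V → V → V → Prop) (m t a b : V) : Prop :=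
  let Q' m t a b := E t m ∧ E a m ∧ E b m ∧ Q t a b
  IsLeastOrd E (fun m => ∃ t a b, Q' m t a b) m ∧ IsLeastOrd E (fun t => ∃ a b, Q' m t a b) t ∧
    IsLeastOrd E (fun a => ∃ b, Q' m t a b) a ∧ IsLeastOrd E (fun b => Q' m t a b) b

variable [Fact (SatisfiesZF E)]

theorem IsLeastTriple.unique {Q : V → V → V → Prop} {m t a b m' t' a' b' : V}
    (h : IsLeastTriple E Q m t a b) (h' : IsLeastTriple E Q m' t' a' b') :
    t' = t ∧ a' = a ∧ b' = b := by
  obtain rfl := h.1.unique h'.1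
  obtain rfl := h.2.1.unique h'.2.1
  obtain rfl := h.2.2.1.unique h'.2.2.1
  exact ⟨rfl, rfl, h'.2.2.2.unique h.2.2.2⟩

theorem exists_isLeastTriple (𝔇 : DefinabilitySystem E) [HasReplacement 𝔇] {Q : V → V → V → Prop}
    [hQ : IsDefinable 𝔇 fun v : Fin 3 → V => Q (v 0) (v 1) (v 2)] {m t a b : V} (hm : IsOrd E m)
    (ht : E t m) (ha : E a m) (hb : E b m) (h : Q t a b) :
    ∃ m' t' a' b', IsLeastTriple E Q m' t' a' b' ∧ E t' m ∧ E a' m ∧ E b' m ∧ Q t' a' b' := by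
  have {n : ℕ} (f g h : (Fin n → V) → V) [IsDefinableFun 𝔇 f] [IsDefinableFun 𝔇 g]
      [IsDefinableFun 𝔇 h] : IsDefinable 𝔇 fun v => Q (f v) (g v) (h v) :=
    IsDefinable.comp₃ Q hQ f g h
  obtain ⟨m', hm'⟩ := exists_isLeastOrd 𝔇
    (fun m => ∃ t a b, E t m ∧ E a m ∧ E b m ∧ Q t a b) hm ⟨t, a, b, ht, ha, hb, h⟩
  obtain ⟨t₁, a₁, b₁, h₁⟩ := hm'.2.1
  obtain ⟨t', ht'⟩ := exists_isLeastOrd 𝔇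
    (fun t => ∃ a b, E t m' ∧ E a m' ∧ E b m' ∧ Q t a b) (hm'.1.mem h₁.1) ⟨a₁, b₁, h₁⟩
  obtain ⟨a₂, b₂, h₂⟩ := ht'.2.1
  obtain ⟨a', ha'⟩ := exists_isLeastOrd 𝔇
    (fun a => ∃ b, E t' m' ∧ E a m' ∧ E b m' ∧ Q t' a b) (hm'.1.mem h₂.2.1) ⟨b₂, h₂⟩
  obtain ⟨b₃, h₃⟩ := ha'.2.1
  obtain ⟨b', hb'⟩ := exists_isLeastOrd 𝔇
    (fun b => E t' m' ∧ E a' m' ∧ E b m' ∧ Q t' a' b) (hm'.1.mem h₃.2.2.1) h₃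
  obtain ⟨ht'm, ha'm, hb'm, hQ'⟩ := hb'.2.1
  have hle {c : V} (hc : E c m') : E c m := by
    rcases hm'.1.trichotomy hm with h' | rfl | h'
    exacts [hm.trans h' hc, hc, (hm'.2.2 m h' ⟨t, a, b, ht, ha, hb, h⟩).elim]
  exact ⟨m', t', a', b', ⟨hm', ht', ha', hb'⟩, hle ht'm, hle ha'm, hle hb'm, hQ'⟩

variable (E)

/-- The value of the function `g` at `x`, and the empty set outside of its domain. -/
noncomputable def app (g x : V) : V := the E fun y => E (opair E x y) g

variable (W : V → V → V)

/-- The value that the operation `W`, with parameter `p`, assigns to the tag `t`, the ordinal `a`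
and the values of `g` at `a` and `b`. -/
noncomputable def candidate (p g t a b : V) : V :=
  W p (opair E t (opair E a (opair E (app E g a) (app E g b))))

/-- The candidate given by the first triple whose candidate is not yet a value of `g`. -/
noncomputable def enumStep (p g : V) : V :=
  the E fun y => ∃ m t a b,
    IsLeastTriple E (fun t a b => ¬ E (candidate E W p g t a b) (ran E g)) m t a b ∧
      y = candidate E W p g t a b

/-- The enumeration, along the ordinals, of the closure of the class of ordinals under `W`. -/
noncomputable def enum (p a : V) : V := ordRec E (enumStep E W) p a

variable {E}

section Definability

variable (f₁ f₂ f₃ f₄ f₅ : (Fin n → V) → V) [IsDefinableFun 𝔇 f₁] [IsDefinableFun 𝔇 f₂]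
  [IsDefinableFun 𝔇 f₃] [IsDefinableFun 𝔇 f₄] [IsDefinableFun 𝔇 f₅]

instance IsDefinableFun.app : IsDefinableFun 𝔇 fun v => app E (f₁ v) (f₂ v) := by
  unfold SetModel.app; infer_instance

variable [IsDefinableFun₂ 𝔇 W]

instance IsDefinableFun.candidate :
    IsDefinableFun 𝔇 fun v => candidate E W (f₁ v) (f₂ v) (f₃ v) (f₄ v) (f₅ v) := by
  unfold SetModel.candidate; infer_instance

instance : IsDefinableFun₂ 𝔇 (enumStep E W) := ⟨by unfold enumStep IsLeastTriple; infer_instance⟩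

instance IsDefinableFun.enum : IsDefinableFun 𝔇 fun v => enum E W (f₁ v) (f₂ v) := by
  unfold SetModel.enum; infer_instance

end Definability

variable {W}

theorem app_eq {g x y : V} (h : ∀ z, E (opair E x z) g ↔ z = y) : app E g x = y :=
  the_eq ((h y).2 rfl) fun z => (h z).1

theorem app_eq_emp {g x : V} (h : ∀ z, ¬ E (opair E x z) g) : app E g x = emp E := the_eq_emp h

theorem enumStep_eq {p g m t a b : V}
    (h : IsLeastTriple E (fun t a b => ¬ E (candidate E W p g t a b) (ran E g)) m t a b) :
    enumStep E W p g = candidate E W p g t a b := by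
  refine the_eq ⟨m, t, a, b, h, rfl⟩ ?_
  rintro _ ⟨m', t', a', b', h', rfl⟩
  obtain ⟨rfl, rfl, rfl⟩ := h.unique h'
  rfl

variable [IsDefinableFun₂ (fullSys E) W]

theorem app_hist_enum {p x a : V} (hx : IsOrd E x) (ha : E a x) :
    app E (hist E (enumStep E W) p x) a = enum E W p a :=
  app_eq fun z => by
    rw [(attempt_hist p hx).mem_iff hx]
    simp only [opair_inj]
    exact ⟨by rintro ⟨_, _, rfl, h⟩; exact h, fun h => ⟨a, ha, rfl, h⟩⟩

theorem exists_enum_eq_of_fresh {p x m t a b : V} (hx : IsOrd E x) (hm : IsOrd E m)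
    (hmx : E m x) (ht : E t m) (ha : E a m) (hb : E b m)
    (hfresh : ∀ y, IsOrd E y → enum E W p y ≠
      W p (opair E t (opair E a (opair E (enum E W p a) (enum E W p b))))) :
    (∃ t a b, E t m ∧ E a m ∧ E b m ∧ enum E W p x =
      W p (opair E t (opair E a (opair E (enum E W p a) (enum E W p b))))) ∧
      ∀ y, E y x → enum E W p y ≠ enum E W p x := by
  set g := hist E (enumStep E W) p x
  have candidate_eq {t a b : V} (ha : E a m) (hb : E b m) : candidate E W p g t a b =
      W p (opair E t (opair E a (opair E (enum E W p a) (enum E W p b)))) := by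
    rw [candidate, app_hist_enum hx (hx.trans hmx ha), app_hist_enum hx (hx.trans hmx hb)]
  have mem_ran {z : V} : E z (ran E g) ↔ ∃ y, E y x ∧ z = enum E W p y := mem_ran_hist hx
  have h : ¬ E (candidate E W p g t a b) (ran E g) := by
    rw [candidate_eq ha hb, mem_ran]
    exact fun ⟨y, hy, h⟩ => hfresh y (hx.mem hy) h.symm
  obtain ⟨m', t', a', b', hleast, ht', ha', hb', h'⟩ :=
    exists_isLeastTriple (fullSys E) (Q := fun t a b => ¬ E (candidate E W p g t a b) (ran E g))
      hm ht ha hb h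
  have enum_eq : enum E W p x = candidate E W p g t' a' b' := enumStep_eq hleast
  rw [← enum_eq, mem_ran] at h'
  exact ⟨⟨t', a', b', ht', ha', hb', enum_eq.trans (candidate_eq ha' hb')⟩,
    fun y hy hyx => h' ⟨y, hy, hyx.symm⟩⟩

theorem exists_enum_eq (p : V) {t a b : V} (ht : IsOrd E t) (ha : IsOrd E a) (hb : IsOrd E b) :
    ∃ x, IsOrd E x ∧ enum E W p x =
      W p (opair E t (opair E a (opair E (enum E W p a) (enum E W p b)))) := by
  by_contra! hcon
  obtain ⟨m, hm, hbd⟩ := exists_ord_bound (E := E) (union E (upair E t a) (upair E b b))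
  simp only [mem_union (E := E), mem_upair (E := E)] at hbd
  obtain ⟨K, hK⟩ := HasReplacement.replacement (𝔇 := fullSys E) (fun q y => ∃ t a b,
    q = opair E t (opair E a b) ∧
      y = W p (opair E t (opair E a (opair E (enum E W p a) (enum E W p b)))))
    inferInstance (prod E m (prod E m m)) (by
      rintro _ - _ _ ⟨t, a, b, rfl, rfl⟩ ⟨t', a', b', h, rfl⟩
      obtain ⟨rfl, rfl, rfl⟩ : t = t' ∧ a = a' ∧ b = b' := by simpa only [opair_inj] using h
      rfl)
  have fresh {x : V} (hx : IsOrd E x) (hmx : E m x) := exists_enum_eq_of_fresh hx hm hmx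
    (hbd t ht (by simp)) (hbd a ha (by simp)) (hbd b hb (by simp)) hcon
  obtain ⟨x, y, hx, hmy, hyx, h⟩ := exists_mem_apply_eq (fun x => enum E W p x) hm K
    fun x hx hmx => by
      obtain ⟨t, a, b, ht, ha, hb, h⟩ := (fresh hx hmx).1
      exact (hK _).2 ⟨_, by simp only [opair_mem_prod, ht, ha, hb, and_self], t, a, b, rfl, h⟩
  exact (fresh hx (hx.trans hyx hmy)).2 y hyx h

theorem enum_induction {P : V → Prop} (p : V) [IsDefinable (fullSys E) fun v : Fin 1 → V => P (v 0)]
    (hemp : P (emp E))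
    (hW : ∀ t a x y, IsOrd E t → IsOrd E a → P x → P y →
      P (W p (opair E t (opair E a (opair E x y))))) {x : V} (hx : IsOrd E x) :
    P (enum E W p x) := by
  have {n : ℕ} (f : (Fin n → V) → V) [IsDefinableFun (fullSys E) f] :
      IsDefinable (fullSys E) fun v => P (f v) := IsDefinable.comp₁ P inferInstance f
  refine ord_induction (fun x => P (enum E W p x)) (fun x hx ih => ?_) hx
  set g := hist E (enumStep E W) p x with hg
  have happ (a : V) : P (app E g a) := by
    by_cases ha : E a x
    · rw [app_hist_enum hx ha]; exact ih a ha
    · rwa [app_eq_emp fun z hz => ha ?_]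
      obtain ⟨b, hb, h⟩ := ((attempt_hist p hx).mem_iff hx).1 hz
      exact (opair_inj.1 h).1 ▸ hb
  by_cases h : ∃ m t a b,
      IsLeastTriple E (fun t a b => ¬ E (candidate E W p g t a b) (ran E g)) m t a b
  · obtain ⟨m, t, a, b, h⟩ := h
    rw [enum, ordRec, ← hg, enumStep_eq h]
    exact hW t a _ _ h.2.1.1 h.2.2.1.1 (happ a) (happ b)
  · rw [enum, ordRec, ← hg, enumStep, the_eq_emp]
    · exact hemp
    · rintro _ ⟨m, t, a, b, h', -⟩
      exact h ⟨m, t, a, b, h'⟩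

end Enumeration

/-! ### The generating operations -/

section Operations

variable {V : Type*} {E : V → V → Prop} {n : ℕ} {𝔇 : DefinabilitySystem E}

variable (E) in
/-- The points at which some value of the relation `f` is an element of some value of the relation
`g`. -/
noncomputable def memLocus [Fact (SatisfiesZF E)] (f g : V) : V :=
  mkSet E fun e => ∃ a, E (opair E e a) f ∧ ∃ b, E (opair E e b) g ∧ E a b

variable [Fact (SatisfiesZF E)]

variable (E)

/-- The first projection, restricted to the pairs in `r`. -/
noncomputable def fstOn (r : V) : V :=
  mkSet E fun q => ∃ x e, E (opair E x e) r ∧ q = opair E (opair E x e) x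

/-- The composition of the second projection, restricted to the pairs in `r`, with the relation
`s`. -/
noncomputable def compSnd (r s : V) : V :=
  mkSet E fun q =>
    ∃ x e a, E (opair E x e) r ∧ E (opair E e a) s ∧ q = opair E (opair E x e) a

/-- The numeral of `k` in `(V, E)`. -/
noncomputable def num : ℕ → V
  | 0 => emp E
  | k + 1 => succ E (num k)

/-- Names of the operations under which `generated` is closed. -/
inductive GenOp
  | ord | param | level | prod | singleton | diff | dom | ran | sUnion | memLocus | fstOn | compSnd

theorem GenOp.ctorIdx_injective : Function.Injective GenOp.ctorIdx := by
  rintro ⟨⟩ ⟨⟩ <;> simp [GenOp.ctorIdx]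

instance : Finite GenOp :=
  have ctorIdx_lt (k : GenOp) : k.ctorIdx < 12 := by cases k <;> decide
  .of_injective (fun k => (⟨k.ctorIdx, ctorIdx_lt k⟩ : Fin 12)) fun _ _ h =>
    GenOp.ctorIdx_injective (Fin.val_eq_of_eq h)

/-- The operation with the given name, for the parameter `p`, the ordinal `a` and the arguments `x`
and `y`. -/
noncomputable def GenOp.eval (p a x y : V) : GenOp → V
  | ord => a
  | param => p
  | level => SetModel.level E a
  | prod => SetModel.prod E x y
  | singleton => upair E x x
  | diff => SetModel.diff E x y
  | dom => SetModel.dom E x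
  | ran => SetModel.ran E x
  | sUnion => SetModel.sUnion E x
  | memLocus => SetModel.memLocus E x y
  | fstOn => SetModel.fstOn E x
  | compSnd => SetModel.compSnd E x y

/-- The generating operations, combined into one that acts on `(t, (a, (x, y)))` by the operation
with the number `t`. -/
noncomputable def applyOp (p q : V) : V :=
  the E fun z => ∃ (k : GenOp) (a x y : V),
    q = opair E (num E k.ctorIdx) (opair E a (opair E x y)) ∧ z = k.eval E p a x y

/-- The closure of the ordinals and of `p` under the generating operations. -/
def generated (p : V) : Set V := {x | ∃ a, IsOrd E a ∧ x = enum E (applyOp E) p a}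

variable {E}

section Definability

variable (f g h k : (Fin n → V) → V) [IsDefinableFun 𝔇 f] [IsDefinableFun 𝔇 g]
  [IsDefinableFun 𝔇 h] [IsDefinableFun 𝔇 k]

instance IsDefinableFun.memLocus : IsDefinableFun 𝔇 fun v => memLocus E (f v) (g v) := by
  unfold SetModel.memLocus; infer_instance

instance IsDefinableFun.fstOn : IsDefinableFun 𝔇 fun v => fstOn E (f v) := by
  unfold SetModel.fstOn; infer_instance

instance IsDefinableFun.compSnd : IsDefinableFun 𝔇 fun v => compSnd E (f v) (g v) := by
  unfold SetModel.compSnd; infer_instance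

instance IsDefinableFun.num : ∀ k : ℕ, IsDefinableFun 𝔇 fun _ : Fin n → V => num E k
  | 0 => by unfold SetModel.num; infer_instance
  | k + 1 => by have := IsDefinableFun.num k; unfold SetModel.num; infer_instance

instance IsDefinableFun.eval (o : GenOp) :
    IsDefinableFun 𝔇 fun v => o.eval E (f v) (g v) (h v) (k v) := by
  cases o <;> unfold GenOp.eval <;> infer_instance

instance : IsDefinableFun₂ 𝔇 (applyOp E) := ⟨by unfold applyOp; infer_instance⟩

instance IsDefinable.generated : IsDefinable 𝔇 fun v => f v ∈ generated E (g v) := by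
  simp only [SetModel.generated, mem_ofPred_eq]; infer_instance

end Definability

theorem mem_memLocus {f g e : V} :
    E e (memLocus E f g) ↔ ∃ a, E (opair E e a) f ∧ ∃ b, E (opair E e b) g ∧ E a b :=
  mem_mkSet_of_subset (sUnion E (sUnion E f)) fun _ ⟨_, h, _⟩ =>
    (mem_sUnion_sUnion_of_opair_mem h).1

theorem mem_fstOn {r q : V} :
    E q (fstOn E r) ↔ ∃ x e, E (opair E x e) r ∧ q = opair E (opair E x e) x := by
  refine mem_mkSet_of_subset (prod E r (sUnion E (sUnion E r))) ?_
  rintro _ ⟨x, e, h, rfl⟩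
  exact opair_mem_prod.2 ⟨h, (mem_sUnion_sUnion_of_opair_mem h).1⟩

theorem mem_compSnd {r s q : V} : E q (compSnd E r s) ↔
    ∃ x e a, E (opair E x e) r ∧ E (opair E e a) s ∧ q = opair E (opair E x e) a := by
  refine mem_mkSet_of_subset (prod E r (sUnion E (sUnion E s))) ?_
  rintro _ ⟨x, e, a, h, h', rfl⟩
  exact opair_mem_prod.2 ⟨h, (mem_sUnion_sUnion_of_opair_mem h').2⟩

theorem isOrd_num : ∀ k : ℕ, IsOrd E (num E k)
  | 0 => isOrd_emp
  | k + 1 => (isOrd_num k).succ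

theorem num_injective : Function.Injective (num E) := by
  have num_mem_num {j k : ℕ} (h : j < k) : E (num E j) (num E k) := by
    induction h with
    | refl => exact mem_succ_self _
    | step _ ih => exact mem_succ.2 (.inl ih)
  intro j k h
  rcases lt_trichotomy j k with hlt | rfl | hlt
  exacts [(mem_irrefl _ (h ▸ num_mem_num hlt)).elim, rfl,
    (mem_irrefl _ (h ▸ num_mem_num hlt)).elim]

theorem applyOp_num (k : GenOp) (p a x y : V) :
    applyOp E p (opair E (num E k.ctorIdx) (opair E a (opair E x y))) = k.eval E p a x y := by
  refine the_eq ⟨k, a, x, y, rfl, rfl⟩ ?_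
  rintro _ ⟨k', a', x', y', h, rfl⟩
  simp only [opair_inj, num_injective.eq_iff, GenOp.ctorIdx_injective.eq_iff] at h
  obtain ⟨rfl, rfl, rfl, rfl⟩ := h
  rfl

variable {p q x y a : V}

theorem eval_enum_mem_generated (k : GenOp) {b : V} (ha : IsOrd E a) (hb : IsOrd E b) :
    k.eval E p a (enum E (applyOp E) p a) (enum E (applyOp E) p b) ∈ generated E p := by
  obtain ⟨x, hx, h⟩ := exists_enum_eq (W := applyOp E) p (isOrd_num k.ctorIdx) ha hb
  exact ⟨x, hx, (h.trans (applyOp_num k ..)).symm⟩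

theorem ord_mem_generated (ha : IsOrd E a) : a ∈ generated E p :=
  eval_enum_mem_generated .ord ha ha

theorem self_mem_generated : p ∈ generated E p :=
  eval_enum_mem_generated .param isOrd_emp isOrd_emp

theorem level_mem_generated (ha : IsOrd E a) : level E a ∈ generated E p :=
  eval_enum_mem_generated .level ha ha

theorem exists_eval_mem_generated (k : GenOp) (hx : x ∈ generated E p) (hy : y ∈ generated E p) :
    ∃ a, k.eval E p a x y ∈ generated E p := by
  obtain ⟨a, ha, rfl⟩ := hx
  obtain ⟨b, hb, rfl⟩ := hy
  exact ⟨a, eval_enum_mem_generated k ha hb⟩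

theorem prod_mem_generated (hx : x ∈ generated E p) (hy : y ∈ generated E p) :
    prod E x y ∈ generated E p :=
  (exists_eval_mem_generated .prod hx hy).choose_spec

theorem singleton_mem_generated (hx : x ∈ generated E p) : upair E x x ∈ generated E p :=
  (exists_eval_mem_generated .singleton hx hx).choose_spec

theorem diff_mem_generated (hx : x ∈ generated E p) (hy : y ∈ generated E p) :
    diff E x y ∈ generated E p :=
  (exists_eval_mem_generated .diff hx hy).choose_spec

theorem dom_mem_generated (hx : x ∈ generated E p) : dom E x ∈ generated E p :=
  (exists_eval_mem_generated .dom hx hx).choose_spec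

theorem ran_mem_generated (hx : x ∈ generated E p) : ran E x ∈ generated E p :=
  (exists_eval_mem_generated .ran hx hx).choose_spec

theorem sUnion_mem_generated (hx : x ∈ generated E p) : sUnion E x ∈ generated E p :=
  (exists_eval_mem_generated .sUnion hx hx).choose_spec

theorem memLocus_mem_generated (hx : x ∈ generated E p) (hy : y ∈ generated E p) :
    memLocus E x y ∈ generated E p :=
  (exists_eval_mem_generated .memLocus hx hy).choose_spec

theorem fstOn_mem_generated (hx : x ∈ generated E p) : fstOn E x ∈ generated E p :=
  (exists_eval_mem_generated .fstOn hx hx).choose_spec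

theorem compSnd_mem_generated (hx : x ∈ generated E p) (hy : y ∈ generated E p) :
    compSnd E x y ∈ generated E p :=
  (exists_eval_mem_generated .compSnd hx hy).choose_spec

theorem eval_mem_generated (hq : q ∈ generated E p) (ha : IsOrd E a) (hx : x ∈ generated E p)
    (hy : y ∈ generated E p) : ∀ k : GenOp, k.eval E q a x y ∈ generated E p
  | .ord => ord_mem_generated ha
  | .param => hq
  | .level => level_mem_generated ha
  | .prod => prod_mem_generated hx hy
  | .singleton => singleton_mem_generated hx
  | .diff => diff_mem_generated hx hy
  | .dom => dom_mem_generated hx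
  | .ran => ran_mem_generated hx
  | .sUnion => sUnion_mem_generated hx
  | .memLocus => memLocus_mem_generated hx hy
  | .fstOn => fstOn_mem_generated hx
  | .compSnd => compSnd_mem_generated hx hy

theorem generated_subset (hq : q ∈ generated E p) : generated E q ⊆ generated E p := by
  rintro _ ⟨x, hx, rfl⟩
  refine enum_induction (P := (· ∈ generated E p)) q (ord_mem_generated isOrd_emp) ?_ hx
  intro t a x y _ ha hx hy
  by_cases h : ∃ k : GenOp, t = num E k.ctorIdx
  · obtain ⟨k, rfl⟩ := h
    rw [applyOp_num]
    exact eval_mem_generated hq ha hx hy k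
  · rw [applyOp, the_eq_emp]
    · exact ord_mem_generated isOrd_emp
    · rintro _ ⟨k, _, _, _, h', -⟩
      exact h ⟨k, (opair_inj.1 h').1⟩

theorem mem_generated_of_singleton (h : upair E x x ∈ generated E p) : x ∈ generated E p := by
  have sUnion_singleton : sUnion E (upair E x x) = x :=
    ext_mem E fun z => by simp [mem_sUnion, mem_upair]
  exact sUnion_singleton ▸ sUnion_mem_generated h

theorem left_mem_generated (h : opair E x y ∈ generated E p) : x ∈ generated E p := by
  refine mem_generated_of_singleton ?_
  convert dom_mem_generated (singleton_mem_generated h)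
  exact ext_mem E fun z => by simp [mem_upair, mem_dom, opair_inj]

theorem right_mem_generated (h : opair E x y ∈ generated E p) : y ∈ generated E p := by
  refine mem_generated_of_singleton ?_
  convert ran_mem_generated (singleton_mem_generated h)
  exact ext_mem E fun z => by simp [mem_upair, mem_ran, opair_inj]

theorem inter_mem_generated (hx : x ∈ generated E p) (hy : y ∈ generated E p) :
    diff E x (diff E x y) ∈ generated E p :=
  diff_mem_generated hx (diff_mem_generated hx hy)

theorem mem_diff_diff {x y z : V} : E z (diff E x (diff E x y)) ↔ E z x ∧ E z y := by
  simp [mem_diff]; tauto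

theorem value_mem_generated {w : V} (hw : w ∈ generated E p) (ha : a ∈ generated E p)
    (h : E (opair E a y) w) (h' : ∀ z, E (opair E a z) w → z = y) : y ∈ generated E p := by
  refine mem_generated_of_singleton ?_
  convert ran_mem_generated (inter_mem_generated hw
    (prod_mem_generated (singleton_mem_generated ha) (ran_mem_generated hw)))
  refine ext_mem E fun z => ?_
  simp only [mem_upair, mem_ran, mem_diff_diff, opair_mem_prod, or_self]
  constructor
  · rintro rfl; exact ⟨a, h, rfl, a, h⟩
  · rintro ⟨b, h1, rfl, -⟩; exact h' z h1

end Operations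

/-! ### Everything definable is generated -/

section Loci

variable {V : Type*} {E : V → V → Prop} {n : ℕ} {𝔇 : DefinabilitySystem E} [Fact (SatisfiesZF E)]

variable (E)

/-- The tuple `xs` as an element of `(V, E)`. The last entry comes first, so that quantifying over
it amounts to taking a range. -/
noncomputable def env : {n : ℕ} → (Fin n → V) → V
  | 0, _ => emp E
  | n + 1, xs => opair E (xs (Fin.last n)) (env (Fin.init xs))

/-- The set of all `n`-tuples of elements of `V_a`. -/
noncomputable def envSet : ℕ → V → V
  | 0, _ => upair E (emp E) (emp E)
  | n + 1, a => prod E (level E a) (envSet n a)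

/-- `s` is the set of all tuples of elements of `V_a` that satisfy `P`. -/
def IsLocus (a : V) (P : (Fin n → V) → Prop) (s : V) : Prop :=
  ∀ e, E e s ↔ ∃ xs, (∀ i, E (xs i) (level E a)) ∧ e = env E xs ∧ P xs

/-- `s` is the graph of the function `F` on the tuples of elements of `V_a`. -/
def IsGraph (a : V) (F : (Fin n → V) → V) (s : V) : Prop :=
  ∀ q, E q s ↔ ∃ xs, (∀ i, E (xs i) (level E a)) ∧ q = opair E (env E xs) (F xs)

/-- For every level of the hierarchy, the set of tuples of its elements that satisfy `P` is
generated from `p`. -/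
def HasLocus (p : V) (P : (Fin n → V) → Prop) : Prop :=
  ∀ a, IsOrd E a → ∃ s ∈ generated E p, IsLocus E a P s

/-- For every level of the hierarchy, the graph of `F` on the tuples of its elements is generated
from `p`. -/
def HasGraph (p : V) (F : (Fin n → V) → V) : Prop :=
  ∀ a, IsOrd E a → ∃ s ∈ generated E p, IsGraph E a F s

variable {E}

theorem env_snoc (xs : Fin n → V) (x : V) :
    env E (Fin.snoc xs x : Fin (n + 1) → V) = opair E x (env E xs) := by
  simp [env]

theorem env_inj : ∀ {n : ℕ} {xs ys : Fin n → V}, env E xs = env E ys ↔ xs = ys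
  | 0, xs, ys => by simp [Subsingleton.elim xs ys]
  | n + 1, xs, ys => by
    rw [env, env, opair_inj, env_inj]
    refine ⟨fun ⟨h, h'⟩ => ?_, by rintro rfl; exact ⟨rfl, rfl⟩⟩
    rw [← Fin.snoc_init_self xs, ← Fin.snoc_init_self ys, h, h']

theorem mem_envSet {a : V} : ∀ {n : ℕ} {e : V},
    E e (envSet E n a) ↔ ∃ xs : Fin n → V, (∀ i, E (xs i) (level E a)) ∧ e = env E xs
  | 0, e => by simp [envSet, env, mem_upair]
  | n + 1, e => by
    simp only [envSet, mem_prod, mem_envSet]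
    constructor
    · rintro ⟨x, _, hx, ⟨xs, hxs, rfl⟩, rfl⟩
      exact ⟨Fin.snoc xs x, Fin.lastCases (by simpa) (by simpa), (env_snoc xs x).symm⟩
    · rintro ⟨xs, hxs, rfl⟩
      exact ⟨_, _, hxs _, ⟨Fin.init xs, fun i => hxs _, rfl⟩, rfl⟩

theorem IsLocus.env_mem {a s : V} {P : (Fin n → V) → Prop} (h : IsLocus E a P s)
    {xs : Fin n → V} : E (env E xs) s ↔ (∀ i, E (xs i) (level E a)) ∧ P xs := by
  rw [h]
  constructor
  · rintro ⟨ys, hys, h, hP⟩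
    obtain rfl := env_inj.1 h
    exact ⟨hys, hP⟩
  · exact fun ⟨h, h'⟩ => ⟨xs, h, rfl, h'⟩

theorem IsGraph.opair_mem {a s : V} {F : (Fin n → V) → V} (h : IsGraph E a F s)
    {xs : Fin n → V} {y : V} :
    E (opair E (env E xs) y) s ↔ (∀ i, E (xs i) (level E a)) ∧ y = F xs := by
  rw [h]
  constructor
  · rintro ⟨ys, hys, h⟩
    obtain ⟨h, h'⟩ := opair_inj.1 h
    obtain rfl := env_inj.1 h
    exact ⟨hys, h'⟩
  · rintro ⟨h, rfl⟩
    exact ⟨xs, h, rfl⟩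

variable {p a : V}

theorem envSet_mem_generated (ha : IsOrd E a) : ∀ n : ℕ, envSet E n a ∈ generated E p
  | 0 => singleton_mem_generated (ord_mem_generated isOrd_emp)
  | n + 1 => prod_mem_generated (level_mem_generated ha) (envSet_mem_generated ha n)

section Terms

theorem hasGraph_const {c : V} (hc : c ∈ generated E p) : HasGraph E p fun _ : Fin n → V => c := by
  intro a ha
  refine ⟨_, prod_mem_generated (envSet_mem_generated ha n) (singleton_mem_generated hc),
    fun q => ?_⟩
  simp only [mem_prod, mem_envSet, mem_upair, or_self]
  constructor
  · rintro ⟨_, _, ⟨xs, h, rfl⟩, rfl, rfl⟩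
    exact ⟨xs, h, rfl⟩
  · rintro ⟨xs, h, rfl⟩
    exact ⟨_, c, ⟨xs, h, rfl⟩, rfl, rfl⟩

theorem hasGraph_last : HasGraph E p fun xs : Fin (n + 1) → V => xs (Fin.last n) := by
  intro a ha
  refine ⟨_, fstOn_mem_generated (envSet_mem_generated ha (n + 1)), fun q => ?_⟩
  simp only [mem_fstOn, mem_envSet]
  constructor
  · rintro ⟨x, e, ⟨xs, h, h'⟩, rfl⟩
    obtain ⟨rfl, rfl⟩ := opair_inj.1 h'
    exact ⟨xs, h, rfl⟩
  · rintro ⟨xs, h, rfl⟩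
    exact ⟨_, _, ⟨xs, h, rfl⟩, rfl⟩

theorem hasGraph_comp_init {F : (Fin n → V) → V} (hF : HasGraph E p F) :
    HasGraph E p fun xs : Fin (n + 1) → V => F (Fin.init xs) := by
  intro a ha
  obtain ⟨f, hf, hf'⟩ := hF a ha
  refine ⟨_, compSnd_mem_generated (envSet_mem_generated ha (n + 1)) hf, fun q => ?_⟩
  simp only [mem_compSnd, mem_envSet]
  constructor
  · rintro ⟨x, e, b, ⟨xs, h, h'⟩, hb, rfl⟩
    obtain ⟨rfl, rfl⟩ := opair_inj.1 h'
    obtain ⟨-, rfl⟩ := hf'.opair_mem.1 hb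
    exact ⟨xs, h, rfl⟩
  · rintro ⟨xs, h, rfl⟩
    exact ⟨_, _, _, ⟨xs, h, rfl⟩, hf'.opair_mem.2 ⟨fun i => h _, rfl⟩, rfl⟩

theorem hasGraph_var : ∀ {n : ℕ} (i : Fin n), HasGraph E p fun xs : Fin n → V => xs i
  | _ + 1, i => Fin.lastCases hasGraph_last (fun i => hasGraph_comp_init (hasGraph_var i)) i

theorem hasGraph_term {α : Type*} {v : α → V} (hv : ∀ i, v i ∈ generated E p)
    (t : langMem.Term (α ⊕ Fin n)) : letI := memStructure E
    HasGraph E p fun xs => t.realize (Sum.elim v xs) :=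
  match t with
  | .var (.inl i) => hasGraph_const (hv i)
  | .var (.inr i) => hasGraph_var i
  | .func f _ => nomatch f

end Terms

section AtomicFormulas

variable {F G : (Fin n → V) → V}

theorem hasLocus_eq (hF : HasGraph E p F) (hG : HasGraph E p G) :
    HasLocus E p fun xs => F xs = G xs := by
  intro a ha
  obtain ⟨f, hf, hf'⟩ := hF a ha
  obtain ⟨g, hg, hg'⟩ := hG a ha
  refine ⟨_, dom_mem_generated (inter_mem_generated hf hg), fun e => ?_⟩
  simp only [mem_dom, mem_diff_diff]
  constructor
  · rintro ⟨y, hy, hy'⟩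
    obtain ⟨xs, h, h'⟩ := (hf' _).1 hy
    obtain ⟨rfl, rfl⟩ := opair_inj.1 h'
    exact ⟨xs, h, rfl, (hg'.opair_mem.1 hy').2⟩
  · rintro ⟨xs, h, rfl, h'⟩
    exact ⟨F xs, hf'.opair_mem.2 ⟨h, rfl⟩, hg'.opair_mem.2 ⟨h, h'⟩⟩

theorem hasLocus_mem (hF : HasGraph E p F) (hG : HasGraph E p G) :
    HasLocus E p fun xs => E (F xs) (G xs) := by
  intro a ha
  obtain ⟨f, hf, hf'⟩ := hF a ha
  obtain ⟨g, hg, hg'⟩ := hG a ha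
  refine ⟨_, memLocus_mem_generated hf hg, fun e => ?_⟩
  rw [mem_memLocus (E := E)]
  constructor
  · rintro ⟨y, hy, z, hz, hyz⟩
    obtain ⟨xs, h, h'⟩ := (hf' _).1 hy
    obtain ⟨rfl, rfl⟩ := opair_inj.1 h'
    obtain ⟨-, rfl⟩ := hg'.opair_mem.1 hz
    exact ⟨xs, h, rfl, hyz⟩
  · rintro ⟨xs, h, rfl, h'⟩
    exact ⟨F xs, hf'.opair_mem.2 ⟨h, rfl⟩, _, hg'.opair_mem.2 ⟨h, rfl⟩, h'⟩

end AtomicFormulas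

section Connectives

theorem hasLocus_false : HasLocus E p fun _ : Fin n → V => False := fun _ _ =>
  ⟨_, ord_mem_generated isOrd_emp, fun e => by simp [not_mem_emp]⟩

variable {P Q : (Fin n → V) → Prop}

theorem hasLocus_imp (hP : HasLocus E p P) (hQ : HasLocus E p Q) :
    HasLocus E p fun xs => P xs → Q xs := by
  intro a ha
  obtain ⟨s, hs, hs'⟩ := hP a ha
  obtain ⟨t, ht, ht'⟩ := hQ a ha
  refine ⟨_, diff_mem_generated (envSet_mem_generated ha n) (diff_mem_generated hs ht),
    fun e => ?_⟩
  simp only [mem_diff, mem_envSet]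
  constructor
  · rintro ⟨⟨xs, h, rfl⟩, h'⟩
    rw [hs'.env_mem, ht'.env_mem] at h'
    exact ⟨xs, h, rfl, by tauto⟩
  · rintro ⟨xs, h, rfl, h'⟩
    rw [hs'.env_mem, ht'.env_mem]
    exact ⟨⟨xs, h, rfl⟩, by tauto⟩

theorem hasLocus_not (hP : HasLocus E p P) : HasLocus E p fun xs => ¬ P xs :=
  hasLocus_imp hP hasLocus_false

end Connectives

section Quantifiers

instance IsDefinableFun.env : ∀ {m : ℕ} (f : Fin m → (Fin n → V) → V) [∀ i, IsDefinableFun 𝔇 (f i)],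
    IsDefinableFun 𝔇 fun v => env E fun i => f i v
  | 0, _, _ => by simp only [SetModel.env]; infer_instance
  | m + 1, f, _ => by
    have := IsDefinableFun.env fun i : Fin m => f i.castSucc
    simp only [SetModel.env, Fin.init_def]
    infer_instance

theorem isDefinable_env {m : ℕ} (P : (Fin m → V) → Prop) [hP : IsDefinable (fullSys E) P] :
    IsDefinable (fullSys E) fun v : Fin 1 → V => ∃ xs, v 0 = env E xs ∧ P xs := by
  let := memStructure E
  have h : IsDefinable (fullSys E) fun w : Fin (1 + m) → V =>
      w (Fin.castAdd m 0) = env E (fun i => w (Fin.natAdd 1 i)) ∧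
        P fun i => w (Fin.natAdd 1 i) := by
    have : IsDefinable (fullSys E) fun w : Fin (1 + m) → V => P fun i => w (Fin.natAdd 1 i) :=
      ⟨(fullSys E).subst _ hP.out⟩
    infer_instance
  have h' : (univ : Set V).Definable langMem _ := h.out
  refine ⟨show (univ : Set V).Definable langMem _ from ?_⟩
  convert (h'.preimage_comp (finSumFinEquiv (m := 1) (n := m)).symm).exists_of_finite using 4
  simp

theorem exists_ord_forall_exists_snoc (P : (Fin (n + 1) → V) → Prop)
    [IsDefinable (fullSys E) P] (ha : IsOrd E a) :
    ∃ m, IsOrd E m ∧ E a m ∧ ∀ xs : Fin n → V, (∀ i, E (xs i) (level E a)) →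
      (∃ x, P (Fin.snoc xs x)) → ∃ x, E x (level E m) ∧ P (Fin.snoc xs x) := by
  let Q (e x : V) : Prop := ∃ ys, opair E x e = env E ys ∧ P ys
  have {k : ℕ} (f g : (Fin k → V) → V) [IsDefinableFun (fullSys E) f]
      [IsDefinableFun (fullSys E) g] : IsDefinable (fullSys E) fun v => Q (f v) (g v) :=
    IsDefinable.comp₁ (fun e => ∃ ys, e = env E ys ∧ P ys) (isDefinable_env P)
      fun v => opair E (g v) (f v)
  have Q_iff {xs : Fin n → V} {x : V} : Q (env E xs) x ↔ P (Fin.snoc xs x) := by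
    simp only [Q, ← env_snoc, env_inj, exists_eq_left']
  obtain ⟨l, hl, hl'⟩ := collection (fullSys E)
    (fun e c => (∃ x, Q e x) → ∃ x, E x (level E c) ∧ Q e x) (envSet E n a) fun e _ => by
      by_cases h : ∃ x, Q e x
      · obtain ⟨x, hx⟩ := h
        obtain ⟨c, hc, hxc⟩ := exists_mem_level (E := E) x
        exact ⟨c, hc, fun _ => ⟨x, hxc, hx⟩⟩
      · exact ⟨a, ha, fun h' => (h h').elim⟩
  obtain ⟨m, hm, hm'⟩ := exists_ord_bound (E := E) (upair E a l)
  refine ⟨m, hm, hm' a ha (mem_upair.2 (.inl rfl)), fun xs hxs ⟨x, hx⟩ => ?_⟩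
  obtain ⟨c, hc, h⟩ := hl' (env E xs) (mem_envSet.2 ⟨xs, hxs, rfl⟩)
  obtain ⟨y, hy, hPy⟩ := h ⟨x, Q_iff.2 hx⟩
  have hlm : E l m := hm' l hl (mem_upair.2 (.inr rfl))
  exact ⟨y, mem_level_of_mem hm (hm.trans hlm hc) hy, Q_iff.1 hPy⟩

theorem hasLocus_exists {P : (Fin (n + 1) → V) → Prop} [IsDefinable (fullSys E) P]
    (hP : HasLocus E p P) : HasLocus E p fun xs : Fin n → V => ∃ x, P (Fin.snoc xs x) := by
  intro a ha
  obtain ⟨m, hm, ham, hreflect⟩ := exists_ord_forall_exists_snoc P ha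
  obtain ⟨s, hs, hs'⟩ := hP m hm
  refine ⟨_, inter_mem_generated (envSet_mem_generated ha n) (ran_mem_generated hs), fun e => ?_⟩
  simp only [mem_diff_diff, mem_envSet, mem_ran]
  constructor
  · rintro ⟨⟨xs, hxs, rfl⟩, x, hx⟩
    rw [← env_snoc, hs'.env_mem] at hx
    exact ⟨xs, hxs, rfl, x, hx.2⟩
  · rintro ⟨xs, hxs, rfl, h⟩
    obtain ⟨x, hx, hPx⟩ := hreflect xs hxs h
    refine ⟨⟨xs, hxs, rfl⟩, x, ?_⟩
    rw [← env_snoc, hs'.env_mem]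
    exact ⟨Fin.lastCases (by simpa) fun i => by simpa using mem_level_of_mem hm ham (hxs i), hPx⟩

theorem hasLocus_all {P : (Fin (n + 1) → V) → Prop} [IsDefinable (fullSys E) P]
    (hP : HasLocus E p P) : HasLocus E p fun xs : Fin n → V => ∀ x, P (Fin.snoc xs x) := by
  simpa only [not_exists, not_not] using hasLocus_not (hasLocus_exists (hasLocus_not hP))

end Quantifiers

section Formulas

theorem hasLocus_realize {α : Type*} {v : α → V} (hv : ∀ i, v i ∈ generated E p)
    (φ : langMem.BoundedFormula α n) : letI := memStructure E
    HasLocus E p fun xs => φ.Realize v xs := by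
  let := memStructure E
  induction φ with
  | falsum => exact hasLocus_false
  | equal t₁ t₂ => exact hasLocus_eq (hasGraph_term hv t₁) (hasGraph_term hv t₂)
  | rel R ts =>
    cases R
    exact hasLocus_mem (hasGraph_term hv (ts 0)) (hasGraph_term hv (ts 1))
  | imp φ ψ h h' => exact hasLocus_imp h h'
  | all φ h =>
    have := isDefinable_realize (E := E) v φ
    exact hasLocus_all h

theorem hasLocus_of_definable {A : Set V} (hA : A ⊆ generated E p) {P : (Fin n → V) → Prop}
    (hP : letI := memStructure E; A.Definable langMem {xs | P xs}) : HasLocus E p P := by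
  let := memStructure E
  obtain ⟨φ, hφ⟩ := definable_iff_exists_formula_sum.1 hP
  let ψ : langMem.BoundedFormula A n := BoundedFormula.relabel (k := 0) id φ
  have realize_iff (xs : Fin n → V) : ψ.Realize (fun a : A => (a : V)) xs ↔ P xs := by
    refine BoundedFormula.realize_relabel.trans (Iff.trans ?_ (Set.ext_iff.1 hφ xs).symm)
    exact iff_of_eq (congr_arg₂ (BoundedFormula.Realize φ) rfl (Subsingleton.elim _ _))
  simpa only [realize_iff] using hasLocus_realize (fun a : A => hA a.2) ψ

theorem mem_generated_of_definable {A : Set V} (hA : A ⊆ generated E p) {x : V}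
    (hx : letI := memStructure E; A.Definable₁ langMem {x}) : x ∈ generated E p := by
  obtain ⟨a, ha, hxa⟩ := exists_mem_level (E := E) x
  obtain ⟨s, hs, hs'⟩ := hasLocus_of_definable (P := fun xs : Fin 1 → V => xs 0 = x) hA hx a ha
  refine mem_generated_of_singleton ?_
  convert dom_mem_generated hs
  refine ext_mem E fun z => ?_
  simp only [mem_upair, mem_dom, or_self]
  constructor
  · rintro rfl
    exact ⟨emp E, (hs' _).2 ⟨fun _ => z, fun _ => hxa, rfl, rfl⟩⟩
  · rintro ⟨y, hy⟩
    obtain ⟨xs, -, h, rfl⟩ := (hs' _).1 hy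
    exact (opair_inj.1 h).1

end Formulas

end Loci

/-! ### Transitive classes -/

section Absoluteness

variable {V : Type*} {E : V → V → Prop} {M : Set V}

variable (E M) in
/-- `M` is a transitive class. -/
def IsTransClass : Prop := ∀ x ∈ M, ∀ y, E y x → y ∈ M

theorem isPair_restrict (hM : IsTransClass E M) {p a b : M} :
    IsPair (restrict E M) p a b ↔ IsPair E (p : V) a b := by
  simp only [IsPair, Subtype.ext_iff]
  refine ⟨fun h z => ⟨fun hz => (h ⟨z, hM p p.2 z hz⟩).1 hz, ?_⟩, fun h z => h z⟩
  rintro (rfl | rfl)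
  exacts [(h a).2 (.inl rfl), (h b).2 (.inr rfl)]

theorem isOrderedPair_restrict (hM : IsTransClass E M) {p a b : M} :
    IsOrderedPair (restrict E M) p a b ↔ IsOrderedPair E (p : V) a b := by
  simp only [IsOrderedPair, isPair_restrict hM]
  constructor
  · rintro ⟨s, t, h⟩
    exact ⟨s, t, h⟩
  · rintro ⟨s, t, hs, ht, h⟩
    exact ⟨⟨s, hM p p.2 s ((h s).2 (.inl rfl))⟩, ⟨t, hM p p.2 t ((h t).2 (.inr rfl))⟩, hs, ht, h⟩

theorem isTransSet_restrict (hM : IsTransClass E M) {a : M} :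
    IsTransSet (restrict E M) a ↔ IsTransSet E (a : V) :=
  ⟨fun h x hx y hy => h ⟨x, hM a a.2 x hx⟩ hx ⟨y, hM x (hM a a.2 x hx) y hy⟩ hy,
    fun h x hx y hy => h x hx y hy⟩

theorem isOrd_restrict (hM : IsTransClass E M) {a : M} :
    IsOrd (restrict E M) a ↔ IsOrd E (a : V) := by
  simp only [IsOrd, isTransSet_restrict hM]
  exact and_congr_right fun _ => ⟨fun h x hx => h ⟨x, hM a a.2 x hx⟩ hx, fun h x hx => h x hx⟩

variable [Fact (SatisfiesZF E)]

theorem coe_opair [Fact (SatisfiesZF (restrict E M))] (hM : IsTransClass E M) (a b : M) :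
    ((opair (restrict E M) a b : M) : V) = opair E (a : V) b :=
  isOrderedPair_iff.1 ((isOrderedPair_restrict hM).1 (isOrderedPair_iff.2 rfl))

theorem IsTransClass.mem_of_opair_mem (hM : IsTransClass E M) {w a b : V} (hw : w ∈ M)
    (h : E (opair E a b) w) : b ∈ M :=
  have upair_mem : upair E a b ∈ M := hM _ (hM w hw _ h) _ (mem_upair.2 (.inr rfl))
  hM _ upair_mem b (mem_upair.2 (.inr rfl))

theorem satisfiesAC_restrict (hM : IsTransClass E M)
    (h : ∀ x ∈ M, (∀ y, E y x → ∃ z, E z y) → ∃ f ∈ M, ∃ c : V → V,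
      (∀ y, E y x → E (c y) y) ∧ ∀ q, E q f ↔ ∃ y, E y x ∧ q = opair E y (c y)) :
    SatisfiesAC (restrict E M) := by
  rintro ⟨x, hx⟩ hne
  obtain ⟨f, hf, c, hc, mem_f⟩ := h x hx fun y hy =>
    have ⟨z, hz⟩ := hne ⟨y, hM x hx y hy⟩ hy
    ⟨z, hz⟩
  have opair_mem_f {y z : V} : E (opair E y z) f ↔ E y x ∧ z = c y := by
    simp only [mem_f, opair_inj]
    exact ⟨by rintro ⟨_, hy, rfl, rfl⟩; exact ⟨hy, rfl⟩, fun ⟨hy, hz⟩ => ⟨y, hy, rfl, hz⟩⟩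
  simp only [isOrderedPair_restrict hM, isOrderedPair_iff]
  refine ⟨⟨f, hf⟩, fun p hp => ?_, fun y hy => ?_⟩
  · obtain ⟨y, hy, hpy⟩ := (mem_f p).1 hp
    have hyM : y ∈ M := hM x hx y hy
    exact ⟨⟨y, hyM⟩, ⟨c y, hM y hyM _ (hc y hy)⟩, hy, hc y hy, hpy⟩
  · have hp : E (opair E y (c y)) f := opair_mem_f.2 ⟨hy, rfl⟩
    refine ⟨⟨c y, hM y y.2 _ (hc y hy)⟩, ⟨⟨_, hM f hf _ hp⟩, hp, rfl⟩, ?_⟩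
    rintro z ⟨⟨_, _⟩, hq, rfl⟩
    exact Subtype.ext (opair_mem_f.1 hq).2

end Absoluteness

/-! ### Hereditarily definable sets -/

section HereditarilyDefinable

variable {V : Type*} {E : V → V → Prop} {n : ℕ} {X : Set V}

theorem mem_OD_iff {a : V} :
    a ∈ OD E X ↔ IsDefinableFun (paramSys E (ordinals E ∪ X)) fun _ : Fin 0 → V => a :=
  ⟨fun h => ⟨⟨h⟩⟩, fun h => h.out.out⟩

theorem isDefinableFun_of_mem_OD {a : V} (ha : a ∈ OD E X) :
    IsDefinableFun (paramSys E (ordinals E ∪ X)) fun _ : Fin n → V => a :=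
  have := mem_OD_iff.1 ha
  IsDefinableFun.subst (fun _ : Fin 0 → V => a) Fin.elim0

theorem mem_OD_of_mem {a : V} (ha : a ∈ X) : a ∈ OD E X :=
  mem_OD_iff.2 (isDefinableFun_paramSys_const _ (.inr ha))

variable [Fact (SatisfiesZF E)] {a b w x y : V}

theorem mem_HOD_iff : a ∈ HOD E X ↔ ∀ x, E x (tcl E a) → x ∈ OD E X := by
  simp [HOD, isTclSingleton_iff]

theorem HOD_subset_OD : HOD E X ⊆ OD E X := fun a ha => mem_HOD_iff.1 ha a (mem_tcl_self a)

theorem isTransClass_HOD : IsTransClass E (HOD E X) := fun a ha b hb =>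
  mem_HOD_iff.2 fun x hx => mem_HOD_iff.1 ha x (mem_tcl.1 hx _ (isTransSet_tcl a)
    (isTransSet_tcl a a (mem_tcl_self a) b hb))

theorem mem_HOD_of_subset (ha : a ∈ OD E X) (h : ∀ b, E b a → b ∈ HOD E X) : a ∈ HOD E X := by
  obtain ⟨s, hs⟩ := isSet_sep (fullSys E) (tcl E a) fun z => z = a ∨ ∃ y, E y a ∧ E z (tcl E y)
  have isTransSet_s : IsTransSet E s := by
    intro z hz u hu
    obtain ⟨hza, hz⟩ := (hs z).1 hz
    refine (hs u).2 ⟨isTransSet_tcl a z hza u hu, .inr ?_⟩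
    rcases hz with rfl | ⟨y, hy, hzy⟩
    exacts [⟨u, hu, mem_tcl_self u⟩, ⟨y, hy, isTransSet_tcl y z hzy u hu⟩]
  refine mem_HOD_iff.2 fun x hx => ?_
  have hxs : E x s := mem_tcl.1 hx s isTransSet_s ((hs a).2 ⟨mem_tcl_self a, .inl rfl⟩)
  rcases ((hs x).1 hxs).2 with rfl | ⟨y, hy, hxy⟩
  exacts [ha, mem_HOD_iff.1 (h y hy) x hxy]

theorem upair_mem_HOD (ha : a ∈ HOD E X) (hb : b ∈ HOD E X) : upair E a b ∈ HOD E X := by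
  refine mem_HOD_of_subset (mem_OD_iff.2 ?_) fun z hz => ?_
  · have := isDefinableFun_of_mem_OD (n := 0) (HOD_subset_OD ha)
    have := isDefinableFun_of_mem_OD (n := 0) (HOD_subset_OD hb)
    infer_instance
  · rcases mem_upair.1 hz with rfl | rfl
    exacts [ha, hb]

theorem opair_mem_HOD (ha : a ∈ HOD E X) (hb : b ∈ HOD E X) : opair E a b ∈ HOD E X :=
  upair_mem_HOD (upair_mem_HOD ha ha) (upair_mem_HOD ha hb)

variable (E)

/-- The element of `y` that comes first in the enumeration of `generated E w`. -/
noncomputable def firstGenerated (w y : V) : V :=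
  the E fun z => ∃ a, IsLeastOrd E (fun a => E (enum E (applyOp E) w a) y) a ∧
    z = enum E (applyOp E) w a

/-- The choice function on `x` that is given by `firstGenerated E w`. -/
noncomputable def choiceFun (w x : V) : V :=
  mkSet E fun q => ∃ y, E y x ∧ q = opair E y (firstGenerated E w y)

variable {E}

section Definability

variable {𝔇 : DefinabilitySystem E} (f g : (Fin n → V) → V) [IsDefinableFun 𝔇 f]
  [IsDefinableFun 𝔇 g]

instance IsDefinableFun.firstGenerated :
    IsDefinableFun 𝔇 fun v => firstGenerated E (f v) (g v) := by
  unfold SetModel.firstGenerated; infer_instance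

instance IsDefinableFun.choiceFun : IsDefinableFun 𝔇 fun v => choiceFun E (f v) (g v) := by
  unfold SetModel.choiceFun; infer_instance

end Definability

theorem firstGenerated_mem (h : ∃ z ∈ generated E w, E z y) : E (firstGenerated E w y) y := by
  obtain ⟨_, ⟨a, ha, rfl⟩, hz⟩ := h
  obtain ⟨b, hb⟩ := exists_isLeastOrd (fullSys E) (fun a => E (enum E (applyOp E) w a) y) ha hz
  have firstGenerated_eq : firstGenerated E w y = enum E (applyOp E) w b := by
    refine the_eq ⟨b, hb, rfl⟩ ?_
    rintro _ ⟨c, hc, rfl⟩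
    rw [hc.unique hb]
  exact firstGenerated_eq ▸ hb.2.1

theorem mem_choiceFun {q : V} :
    E q (choiceFun E w x) ↔ ∃ y, E y x ∧ q = opair E y (firstGenerated E w y) :=
  mem_mkSet (isSet_image x fun y => opair E y (firstGenerated E w y))

theorem choiceFun_mem_HOD (hw : w ∈ OD E X) (hx : x ∈ HOD E X)
    (h : ∀ y, E y x → E (firstGenerated E w y) y) : choiceFun E w x ∈ HOD E X := by
  refine mem_HOD_of_subset (mem_OD_iff.2 ?_) fun q hq => ?_
  · have := isDefinableFun_of_mem_OD (n := 0) (HOD_subset_OD hx)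
    have := isDefinableFun_of_mem_OD (n := 0) hw
    infer_instance
  · obtain ⟨y, hy, rfl⟩ := mem_choiceFun.1 hq
    have hyX : y ∈ HOD E X := isTransClass_HOD x hx y hy
    exact opair_mem_HOD hyX (isTransClass_HOD y hyX _ (h y hy))

theorem satisfiesAC_HOD
    (h : ∀ x, (∀ z, E z x → z ∈ OD E X) → ∃ w ∈ OD E X, ∀ z, E z x → z ∈ generated E w) :
    SatisfiesAC (restrict E (HOD E X)) := by
  refine satisfiesAC_restrict isTransClass_HOD fun x hx hne => ?_
  have sUnion_subset (z : V) (hz : E z (sUnion E x)) : z ∈ OD E X := by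
    obtain ⟨y, hy, hz⟩ := mem_sUnion.1 hz
    exact HOD_subset_OD (isTransClass_HOD y (isTransClass_HOD x hx y hy) z hz)
  obtain ⟨w, hw, hgen⟩ := h (sUnion E x) sUnion_subset
  have hfirst (y : V) (hy : E y x) : E (firstGenerated E w y) y := by
    obtain ⟨z, hz⟩ := hne y hy
    exact firstGenerated_mem ⟨z, hgen z (mem_sUnion.2 ⟨y, hy, hz⟩), hz⟩
  exact ⟨choiceFun E w x, choiceFun_mem_HOD hw hx hfirst, firstGenerated E w, hfirst,
    fun _ => mem_choiceFun⟩

end HereditarilyDefinable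

/-! ### Inner models with choice -/

section WellOrdering

variable {V : Type*} {E : V → V → Prop} [Fact (SatisfiesZF E)]

theorem SatisfiesAC.exists_app_mem (hAC : SatisfiesAC E) {x : V}
    (hx : ∀ y, E y x → ∃ z, E z y) : ∃ f, ∀ y, E y x → E (app E f y) y := by
  obtain ⟨f, hf, hf'⟩ := hAC x hx
  simp only [isOrderedPair_iff, exists_eq_right] at hf hf'
  refine ⟨f, fun y hy => ?_⟩
  obtain ⟨z, hz, hz'⟩ := hf' y hy
  obtain ⟨y', z', -, hzy, h⟩ := hf _ hz
  obtain ⟨rfl, rfl⟩ := opair_inj.1 h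
  rwa [app_eq fun u => ⟨hz' u, by rintro rfl; exact hz⟩]

theorem exists_subset_ran_hist {N : V → V → V} [IsDefinableFun₂ (fullSys E) N] {p u : V}
    (hN : ∀ g, (∃ z, E z (diff E u (ran E g))) → E (N p g) (diff E u (ran E g))) :
    ∃ a, IsOrd E a ∧ ∀ z, E z u → E z (ran E (hist E N p a)) := by
  by_contra! h
  have ordRec_mem {a : V} (ha : IsOrd E a) :
      E (ordRec E N p a) u ∧ ¬ E (ordRec E N p a) (ran E (hist E N p a)) := by
    obtain ⟨z, hz, hz'⟩ := h a ha
    exact mem_diff.1 (hN _ ⟨z, mem_diff.2 ⟨hz, hz'⟩⟩)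
  obtain ⟨a, b, ha, -, hba, hab⟩ := exists_mem_apply_eq (fun a => ordRec E N p a)
    (isOrd_emp (E := E)) u fun a ha _ => (ordRec_mem ha).1
  exact (ordRec_mem ha).2 ((mem_ran_hist ha).2 ⟨b, hba, hab.symm⟩)

theorem SatisfiesAC.exists_enumeration (hAC : SatisfiesAC E) (u : V) :
    ∃ w, (∀ p, E p u → ∃ a, IsOrd E a ∧ E (opair E a p) w) ∧
      ∀ a p q, E (opair E a p) w → E (opair E a q) w → p = q := by
  obtain ⟨x, hx⟩ := isSet_sep (fullSys E) (powerset E u) fun y => ∃ z, E z y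
  obtain ⟨f, hf⟩ := hAC.exists_app_mem fun y hy => ((hx y).1 hy).2
  let N : V → V → V := fun _ g => app E f (diff E u (ran E g))
  have : IsDefinableFun₂ (fullSys E) N := ⟨by simp only [N]; infer_instance⟩
  obtain ⟨a, ha, h⟩ := exists_subset_ran_hist (N := N) (p := u) (u := u) fun g hg =>
    hf _ ((hx _).2 ⟨mem_powerset.2 fun z hz => (mem_diff.1 hz).1, hg⟩)
  have opair_mem_hist {b p : V} (h : E (opair E b p) (hist E N u a)) :
      E b a ∧ p = ordRec E N u b := by
    obtain ⟨c, hc, h⟩ := ((attempt_hist u ha).mem_iff ha).1 h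
    obtain ⟨rfl, rfl⟩ := opair_inj.1 h
    exact ⟨hc, rfl⟩
  refine ⟨hist E N u a, fun p hp => ?_, fun b p q hp hq =>
    (opair_mem_hist hp).2.trans (opair_mem_hist hq).2.symm⟩
  obtain ⟨b, hb⟩ := mem_ran.1 (h p hp)
  exact ⟨b, ha.mem (opair_mem_hist hb).1, hb⟩

end WellOrdering

namespace IsInnerModel

variable {V : Type*} {E : V → V → Prop} [Fact (SatisfiesZF E)] {M : Set V} {x : V}

theorem opair_mem (hM : IsInnerModel E M) {p q : V} (hp : p ∈ M) (hq : q ∈ M) :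
    opair E p q ∈ M := by
  have : Fact (SatisfiesZF (restrict E M)) := ⟨hM.satisfiesZF⟩
  rw [← coe_opair hM.transitive ⟨p, hp⟩ ⟨q, hq⟩]
  exact Subtype.coe_prop _

theorem exists_finset_subset_generated (hM : IsInnerModel E M) (s : Finset V)
    (hs : (s : Set V) ⊆ M) : ∃ p ∈ M, (s : Set V) ⊆ generated E p := by
  induction s using Finset.cons_induction with
  | empty => exact ⟨emp E, hM.ordinals_subset isOrd_emp, by simp⟩
  | cons a s ha ih =>
    simp only [Finset.coe_cons, insert_subset_iff] at hs ⊢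
    obtain ⟨p, hp, h⟩ := ih hs.2
    have hpa : opair E p a ∈ generated E (opair E p a) := self_mem_generated
    exact ⟨opair E p a, hM.opair_mem hp hs.1, right_mem_generated hpa,
      h.trans (generated_subset (left_mem_generated hpa))⟩

theorem exists_mem_generated (hM : IsInnerModel E M) {z : V} (hz : z ∈ OD E M) :
    ∃ p ∈ M, z ∈ generated E p := by
  let := memStructure E
  obtain ⟨s, hs, hz⟩ := definable_iff_finitely_definable.1 hz
  obtain ⟨p, hp, hsp⟩ := hM.exists_finset_subset_generated s
    (hs.trans (union_subset hM.ordinals_subset subset_rfl))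
  exact ⟨p, hp, mem_generated_of_definable hsp hz⟩

theorem collection (hM : IsInnerModel E M) (R : V → V → Prop)
    [hR : IsDefinable (predSys E M) fun v : Fin 2 → V => R (v 0) (v 1)]
    (h : ∀ z, E z x → ∃ p ∈ M, R z p) : ∃ u ∈ M, ∀ z, E z x → ∃ p, E p u ∧ R z p := by
  have : Fact (SatisfiesZF (restrict E M)) := ⟨hM.satisfiesZF⟩
  have := hM.hasReplacement
  let S (p a : V) : Prop :=
    ∃ (hp : p ∈ M) (ha : a ∈ M), restrict E M ⟨p, hp⟩ (level (restrict E M) ⟨a, ha⟩)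
  have hS : IsDefinable (predSys E M) fun v : Fin 2 → V => S (v 0) (v 1) :=
    .of_relativize (isDefinable_predSys_pred M)
      (R := fun p a => restrict E M p (level (restrict E M) a)) inferInstance
  have {n : ℕ} (f g : (Fin n → V) → V) [IsDefinableFun (predSys E M) f]
      [IsDefinableFun (predSys E M) g] : IsDefinable (predSys E M) fun v => S (f v) (g v) :=
    .comp₂ S hS f g
  have {n : ℕ} (f g : (Fin n → V) → V) [IsDefinableFun (predSys E M) f]
      [IsDefinableFun (predSys E M) g] : IsDefinable (predSys E M) fun v => R (f v) (g v) :=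
    .comp₂ R hR f g
  obtain ⟨l, hl, h'⟩ := SetModel.collection (predSys E M) (fun z a => ∃ p, S p a ∧ R z p) x
    fun z hz => by
      obtain ⟨p, hp, hzp⟩ := h z hz
      obtain ⟨a, ha, hpa⟩ := exists_mem_level (E := restrict E M) ⟨p, hp⟩
      exact ⟨a, (isOrd_restrict hM.transitive).1 ha, p, ⟨hp, a.2, hpa⟩, hzp⟩
  let l' : M := ⟨l, hM.ordinals_subset hl⟩
  have hl' : IsOrd (restrict E M) l' := (isOrd_restrict hM.transitive).2 hl
  let u : M := level (restrict E M) l'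
  refine ⟨u, u.2, fun z hz => ?_⟩
  obtain ⟨a, ha, p, ⟨hp, haM, hpa⟩, hzp⟩ := h' z hz
  have ha' : restrict E M ⟨a, haM⟩ l' := ha
  exact ⟨p, mem_level_of_mem hl' ha' hpa, hzp⟩

theorem exists_generator (hM : IsInnerModel E M) (hAC : SatisfiesAC (restrict E M)) {u : V}
    (hu : u ∈ M) : ∃ w ∈ M, ∀ p, E p u → p ∈ generated E w := by
  have : Fact (SatisfiesZF (restrict E M)) := ⟨hM.satisfiesZF⟩
  obtain ⟨w, hw, hw'⟩ := hAC.exists_enumeration ⟨u, hu⟩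
  have opair_mem_iff (b q : M) :
      restrict E M (opair (restrict E M) b q) w ↔ E (opair E (b : V) q) w := by
    rw [← coe_opair hM.transitive]; rfl
  refine ⟨w, w.2, fun p hp => ?_⟩
  have hpM : p ∈ M := hM.transitive u hu p hp
  obtain ⟨b, hb, hbp⟩ := hw ⟨p, hpM⟩ hp
  refine value_mem_generated self_mem_generated
    (ord_mem_generated ((isOrd_restrict hM.transitive).1 hb)) ((opair_mem_iff _ _).1 hbp)
    fun q hq => ?_
  have hqM : q ∈ M := IsTransClass.mem_of_opair_mem hM.transitive w.2 hq
  exact congr_arg Subtype.val (hw' b ⟨q, hqM⟩ ⟨p, hpM⟩ ((opair_mem_iff _ _).2 hq) hbp)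

theorem exists_common_generator (hM : IsInnerModel E M) (hAC : SatisfiesAC (restrict E M))
    (hx : ∀ z, E z x → z ∈ OD E M) : ∃ w ∈ M, ∀ z, E z x → z ∈ generated E w := by
  obtain ⟨u, hu, hxu⟩ := hM.collection (fun z p => z ∈ generated E p) fun z hz =>
    hM.exists_mem_generated (hx z hz)
  obtain ⟨w, hw, huw⟩ := hM.exists_generator hAC hu
  refine ⟨w, hw, fun z hz => ?_⟩
  obtain ⟨p, hpu, hzp⟩ := hxu z hz
  exact generated_subset (huw p hpu) hzp

end IsInnerModel

end SetModel

theorem theorem7p3p1 {V : Type*} (E : V → V → Prop) (hV : SetModel.SatisfiesZF E) :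
    SetModel.SatisfiesAC (SetModel.restrict E (SetModel.HOD E ∅)) ∧
    ∀ M : Set V, SetModel.IsInnerModel E M →
      SetModel.SatisfiesAC (SetModel.restrict E M) →
      SetModel.SatisfiesAC (SetModel.restrict E (SetModel.HOD E M)) := by
  have : Fact (SetModel.SatisfiesZF E) := ⟨hV⟩
  constructor
  · refine SetModel.satisfiesAC_HOD fun x hx =>
      ⟨SetModel.emp E, SetModel.mem_OD_iff.2 inferInstance, fun z hz => ?_⟩
    have ordinals_subset : SetModel.ordinals E ∪ ∅ ⊆ SetModel.generated E (SetModel.emp E) :=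
      Set.union_subset (fun _ => SetModel.ord_mem_generated) (Set.empty_subset _)
    exact SetModel.mem_generated_of_definable ordinals_subset (hx z hz)
  · refine fun M hM hAC => SetModel.satisfiesAC_HOD fun x hx => ?_
    obtain ⟨w, hw, hxw⟩ := hM.exists_common_generator hAC hx
    exact ⟨w, SetModel.mem_OD_of_mem hw, hxw⟩
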